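/- Fix a dimension $d$. For each sample size $n$ let $v_1,\dots,v_n$ (which may depend on $n$, as a triangular array, and may live on a probability space depending on $n$) be independent random vectors in $\mathbb{R}^d$ with mean zero and with fourth moments bounded uniformly: there is $C<\infty$ such that $E[v_{il}^4]\le C$ for all $n$, all $i=1,\dots,n$ and all coordinates $l=1,\dots,d$. Let $s_1,\dots,s_n\in\mathbb{R}^d$ be nonstochastic vectors, $G=(G_{ij})$ a nonstochastic real $n\times n$ matrix (not required to be symmetric), and $A$ a nonstochastic real $d\times d$ matrix; $s_i$, $G$ and $A$ may depend on $n$, the entries of $A$ being bounded uniformly in $n$ (for instance, $A$ fixed). Put \[ T=\sum_{i=1}^n s_i'v_i+\sum_{i=1}^n\sum_{j\ne i}G_{ij}\,v_i'Av_j . \] Suppose that, as $n\to\infty$, 1. $\mathrm{Var}(T)^{-1/2}$ is bounded, that is, for some $C<\infty$ one has $\mathrm{Var}(T)>0$ and $\mathrm{Var}(T)^{-1/2}\le C$ for all sufficiently large $n$; 2. $\sum_{i=1}^n s_{il}^4\to0$ for every $l=1,\dots,d$; and 3. $\|G_LG_L'\|_F+\|G_UG_U'\|_F\to0$, where $G_L$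 and $G_U$ are the strictly lower- and strictly upper-triangular parts of $G$, with elements $G_{L,ij}=G_{ij}1\{i>j\}$ and $G_{U,ij}=G_{ij}1\{i<j\}$, and $\|\cdot\|_F$ is the Frobenius norm. Then $\mathrm{Var}(T)^{-1/2}\,T\xrightarrow{d}N(0,1)$ as $n\to\infty$. -/

import Mathlib

open MeasureTheory ProbabilityTheory Filter Topology
open scoped Matrix

/- The norm on real matrices is the Frobenius norm. -/
attribute [local instance] Matrix.frobeniusNormedAddCommGroup

/-- The strictly lower-triangular part `G_L` of `G`: the entries `G i j` with `i > j`. -/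
def strictLower {n : ℕ} (G : Matrix (Fin n) (Fin n) ℝ) : Matrix (Fin n) (Fin n) ℝ :=
  Matrix.of fun i j => if i > j then G i j else 0

/-- The strictly upper-triangular part `G_U` of `G`: the entries `G i j` with `i < j`. -/
def strictUpper {n : ℕ} (G : Matrix (Fin n) (Fin n) ℝ) : Matrix (Fin n) (Fin n) ℝ :=
  Matrix.of fun i j => if i < j then G i j else 0

/-- The random variable `T = ∑ i, sᵢ' vᵢ + ∑ i, ∑ j ≠ i, G i j * vᵢ' A vⱼ`. -/
def quadraticStat {Ω : Type*} {n d : ℕ} (s : Fin n → Fin d → ℝ)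
    (G : Matrix (Fin n) (Fin n) ℝ) (A : Matrix (Fin d) (Fin d) ℝ)
    (v : Fin n → Ω → Fin d → ℝ) (ω : Ω) : ℝ :=
  (∑ i, s i ⬝ᵥ v i ω) +
    ∑ i, ∑ j ∈ Finset.univ.filter (fun j => j ≠ i), G i j * (v i ω ⬝ᵥ (A *ᵥ v j ω))

/-! Order the indices and attach each product of `v i` and `v j` to the larger one. Then T becomes a
sum of terms X_k = w_k'v_k, where w_k is s_k plus a linear combination of the v_j with j < k
(`quadraticStat_eq_sum_weightedDiff`). These are martingale differences for the filtration generated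
by the v's, with conditional variances w_k'Σ_k w_k, where Σ_k is the covariance matrix of v_k. After
scaling T to unit variance, asymptotic normality needs two facts: ∑ E X_k⁴ → 0, and V = ∑ w_k'Σ_k
w_k is close to its mean 1.

The first fact is `sum_integral_weightedDiff_pow_four_le`: beyond ∑ s⁴, the bound involves only
squared diagonal entries of Gram matrices bb' of the triangular coefficient matrices b.

The second is `integral_sum_covForm_weight`: V - EV is a linear form plus a centered quadratic form
in the v's. The quadratic form has coefficient matrices b'Db' type products with D diagonal and
bounded, whose Frobenius norms are controlled by those of the Gram matrices
(`sum_sq_sum_weighted_mul_le`). The linear form has coefficients b'r with r_k = Σ_k s_k, and |b'r|²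
≤ ‖bb'‖_F |r|². No bound on ∑ |s_k|² is available, but |Σ_k s_k|² is at most a multiple of s_k'Σ_k
s_k, whose sum is at most EV (`sq_sum_coordCov_mul_le`).

The limit theorem itself is the characteristic function estimate
`IsMartingaleDifference.norm_integral_exp_sub_le`. With S_k and V_k the partial sums of differences
and conditional variances, exp(itS_k + t²V_k/2) has almost constant expectation; stopping before V_k
exceeds 2 keeps it bounded, and V ≈ 1 allows t²V/2 to be replaced by t²/2. All errors are explicit
for each n, so triangular arrays on varying probability spaces need no extra care. -/

/-! ### A quantitative martingale central limit theorem. -/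

section MartingaleDifferences

variable {Ω : Type*} {m : MeasurableSpace Ω}

/-- `X` is a sequence of martingale differences with respect to `F`, with finite fourth moments
and conditional variances `q`. The conditional expectations are expressed by testing against
bounded complex functions. -/
structure IsMartingaleDifference (μ : Measure Ω) (F : ℕ → MeasurableSpace Ω)
    (X q : ℕ → Ω → ℝ) : Prop where
  le : ∀ k, F k ≤ m
  mono : Monotone F
  measurable_diff : ∀ k, Measurable[F (k + 1)] (X k)
  measurable_condVar : ∀ k, Measurable[F k] (q k)
  condVar_nonneg : ∀ k ω, 0 ≤ q k ω
  integrable_condVar : ∀ k, Integrable (q k) μ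
  integrable_pow_four : ∀ k, Integrable (fun ω => X k ω ^ 4) μ
  integral_mul : ∀ k (Y : Ω → ℂ), Measurable[F k] Y → (∃ C, ∀ ω, ‖Y ω‖ ≤ C) →
    ∫ ω, Y ω * (X k ω : ℂ) ∂μ = 0
  integral_mul_sq : ∀ k (Y : Ω → ℂ), Measurable[F k] Y → (∃ C, ∀ ω, ‖Y ω‖ ≤ C) →
    ∫ ω, Y ω * ((X k ω ^ 2 : ℝ) : ℂ) ∂μ = ∫ ω, Y ω * (q k ω : ℂ) ∂μ

lemma memLp_four_iff_integrable_pow {μ : Measure Ω} {f : Ω → ℝ} (hf : Measurable f) :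
    MemLp f 4 μ ↔ Integrable (fun ω => f ω ^ 4) μ := by
  rw [← integrable_norm_rpow_iff hf.aestronglyMeasurable (by norm_num) (by norm_num)]
  have : (fun ω => ‖f ω‖ ^ (4 : ENNReal).toReal) = fun ω => f ω ^ 4 := by
    ext ω
    simp [Real.norm_eq_abs]
    exact Even.pow_abs (by decide) _
  rw [this]

/-- For |x| ≤ 1 this is the Taylor remainder; for |x| > 1 every term is separately dominated by
|x|³. The constant 4 is not sharp. -/
lemma norm_exp_mul_I_sub_taylor_le (x : ℝ) :
    ‖Complex.exp (x * Complex.I) - (1 + x * Complex.I - (x ^ 2 / 2 : ℝ))‖ ≤ 4 * |x| ^ 3 := by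
  rcases le_or_gt |x| 1 with h | h
  · have hn : ‖(x : ℂ) * Complex.I‖ = |x| := by simp
    have := Complex.exp_bound (x := (x : ℂ) * Complex.I) (by rw [hn]; exact h) (n := 3) (by norm_num)
    rw [hn] at this
    have h2 : ∑ j ∈ Finset.range 3, ((x : ℂ) * Complex.I) ^ j / (j.factorial : ℂ)
        = 1 + x * Complex.I - (x ^ 2 / 2 : ℝ) := by
      simp [Finset.sum_range_succ, mul_pow]
      ring
    rw [h2] at this
    refine this.trans ?_
    have h3 : (0 : ℝ) ≤ |x| ^ 3 := by positivity
    norm_num [Nat.factorial]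
    nlinarith
  · have h1 : ‖Complex.exp (x * Complex.I) - (1 + x * Complex.I - (x ^ 2 / 2 : ℝ))‖
        ≤ 1 + (1 + |x| + |x| ^ 2 / 2) := by
      refine (norm_sub_le _ _).trans ?_
      rw [Complex.norm_exp_ofReal_mul_I]
      gcongr
      refine (norm_sub_le _ _).trans ?_
      gcongr
      · refine (norm_add_le _ _).trans ?_
        simp
      · rw [Complex.norm_real, Real.norm_eq_abs, abs_div, abs_pow]
        simp
    refine h1.trans ?_
    have : |x| ≤ |x| ^ 2 := by nlinarith
    have : |x| ^ 2 ≤ |x| ^ 3 := by nlinarith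
    linarith

/-- Trades the cubic Taylor remainder for second and fourth moments. The second moments have a
bounded sum and the fourth a vanishing one, so a suitable δ makes both terms small. -/
lemma abs_pow_three_le (x : ℝ) {δ : ℝ} (hδ : 0 < δ) : |x| ^ 3 ≤ δ * x ^ 2 + x ^ 4 / δ := by
  have h : |x| ≤ δ + |x| ^ 2 / δ := by
    rw [← sub_le_iff_le_add', le_div_iff₀ hδ]
    nlinarith [sq_nonneg (|x| - δ), sq_nonneg (|x|), sq_nonneg δ]
  calc |x| ^ 3 = |x| ^ 2 * |x| := by ring
    _ ≤ |x| ^ 2 * (δ + |x| ^ 2 / δ) := by gcongr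
    _ = δ * |x| ^ 2 + (|x| ^ 2) ^ 2 / δ := by ring
    _ = δ * x ^ 2 + x ^ 4 / δ := by rw [sq_abs]; ring

/-- Follows from 1 - a ≤ exp (-a) ≤ 1 - a + a² on multiplying by exp a. With a = t²q/2 it measures
how well the compensator cancels the quadratic term of exp(itX). -/
lemma abs_exp_mul_one_sub_sub_one_le {a : ℝ} (ha : 0 ≤ a) :
    |Real.exp a * (1 - a) - 1| ≤ Real.exp a * a ^ 2 := by
  have h1 : 1 - a ≤ Real.exp (-a) := Real.one_sub_le_exp_neg a
  have h2 : Real.exp (-a) ≤ 1 - a + a ^ 2 := by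
    rw [Real.exp_neg]
    have h3 : 1 + a ≤ Real.exp a := by linarith [Real.add_one_le_exp a]
    calc (Real.exp a)⁻¹ ≤ (1 + a)⁻¹ := by gcongr
      _ ≤ 1 - a + a ^ 2 := by
        rw [inv_le_iff_one_le_mul₀ (by positivity)]
        nlinarith [pow_nonneg ha 3]
  have h4 : Real.exp a * Real.exp (-a) = 1 := by rw [← Real.exp_add]; simp
  have h5 : 0 < Real.exp a := Real.exp_pos a
  rw [abs_le]
  constructor <;> nlinarith

namespace IsMartingaleDifference

variable {μ : Measure Ω} {F : ℕ → MeasurableSpace Ω} {X q : ℕ → Ω → ℝ}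

lemma measurable (h : IsMartingaleDifference μ F X q) (k : ℕ) : Measurable (X k) :=
  (h.measurable_diff k).mono (h.le _) le_rfl

lemma measurable_q (h : IsMartingaleDifference μ F X q) (k : ℕ) : Measurable (q k) :=
  (h.measurable_condVar k).mono (h.le _) le_rfl

lemma integral_real_mul_sq (h : IsMartingaleDifference μ F X q) (k : ℕ) {Y : Ω → ℝ}
    (hY : Measurable[F k] Y) {C : ℝ} (hC : ∀ ω, |Y ω| ≤ C) :
    ∫ ω, Y ω * X k ω ^ 2 ∂μ = ∫ ω, Y ω * q k ω ∂μ := by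
  have := h.integral_mul_sq k (fun ω => (Y ω : ℂ)) (Complex.measurable_ofReal.comp hY)
    ⟨C, by simpa using hC⟩
  simp only [← Complex.ofReal_mul] at this
  rw [integral_complex_ofReal, integral_complex_ofReal] at this
  exact_mod_cast this

lemma memLp_four (h : IsMartingaleDifference μ F X q) (k : ℕ) : MemLp (X k) 4 μ :=
  (memLp_four_iff_integrable_pow (h.measurable k)).2 (h.integrable_pow_four k)

lemma integral_sq (h : IsMartingaleDifference μ F X q) (k : ℕ) :
    ∫ ω, X k ω ^ 2 ∂μ = ∫ ω, q k ω ∂μ := by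
  simpa using h.integral_real_mul_sq k (Y := fun _ => 1) measurable_const (C := 1) (by simp)

/-- The martingale differences stopped before the sum of the conditional variances exceeds `2`. -/
lemma stopped (h : IsMartingaleDifference μ F X q) :
    IsMartingaleDifference μ F
      (fun k => {ω | ∑ j ∈ Finset.range (k + 1), q j ω ≤ 2}.indicator (X k))
      (fun k => {ω | ∑ j ∈ Finset.range (k + 1), q j ω ≤ 2}.indicator (q k)) := by
  -- The sum includes q k, which is already `F k`-measurable, so the truncation of X k is
  -- predictable and its indicator can be absorbed into the test function.
  have mV : ∀ k, MeasurableSet[F k] {ω | ∑ j ∈ Finset.range (k + 1), q j ω ≤ 2} := fun k => by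
    have hm : Measurable[F k] (fun ω => ∑ j ∈ Finset.range (k + 1), q j ω) :=
      Finset.measurable_fun_sum _ fun j hj =>
        (h.measurable_condVar j).mono (h.mono (Nat.lt_succ_iff.1 (Finset.mem_range.1 hj))) le_rfl
    exact hm measurableSet_Iic
  have mV' : ∀ k, MeasurableSet {ω | ∑ j ∈ Finset.range (k + 1), q j ω ≤ 2} :=
    fun k => h.le k _ (mV k)
  have hY : ∀ k (Y : Ω → ℂ), Measurable[F k] Y → (∃ C, ∀ ω, ‖Y ω‖ ≤ C) →
      Measurable[F k] ({ω | ∑ j ∈ Finset.range (k + 1), q j ω ≤ 2}.indicator Y) ∧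
      ∃ C, ∀ ω, ‖{ω | ∑ j ∈ Finset.range (k + 1), q j ω ≤ 2}.indicator Y ω‖ ≤ C := by
    rintro k Y hY ⟨C, hC⟩
    exact ⟨hY.indicator (mV k), C, fun ω => (norm_indicator_le_norm_self _ _).trans (hC ω)⟩
  refine ⟨h.le, h.mono, fun k => ?_, fun k => ?_, fun k ω => ?_, fun k => ?_, fun k => ?_,
    fun k Y hYm hYb => ?_, fun k Y hYm hYb => ?_⟩
  · exact (h.measurable_diff k).indicator (h.mono (Nat.le_succ k) _ (mV k))
  · exact (h.measurable_condVar k).indicator (mV k)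
  · exact Set.indicator_nonneg (fun ω _ => h.condVar_nonneg k ω) ω
  · exact (h.integrable_condVar k).indicator (mV' k)
  · convert! (h.integrable_pow_four k).indicator (mV' k) using 2 with ω
    by_cases hω : ω ∈ {ω | ∑ j ∈ Finset.range (k + 1), q j ω ≤ 2} <;> simp [hω]
  · obtain ⟨h1, h2⟩ := hY k Y hYm hYb
    rw [← h.integral_mul k _ h1 h2]
    congr 1 with ω
    by_cases hω : ω ∈ {ω | ∑ j ∈ Finset.range (k + 1), q j ω ≤ 2} <;> simp [hω]
  · obtain ⟨h1, h2⟩ := hY k Y hYm hYb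
    convert! h.integral_mul_sq k _ h1 h2 using 2
    all_goals
      ext ω
      by_cases hω : ω ∈ {ω | ∑ j ∈ Finset.range (k + 1), q j ω ≤ 2} <;> simp [hω]

variable [IsProbabilityMeasure μ]

lemma integrable_sq (h : IsMartingaleDifference μ F X q) (k : ℕ) :
    Integrable (fun ω => X k ω ^ 2) μ :=
  ((h.memLp_four k).mono_exponent (by norm_num)).integrable_sq

lemma integrable_diff (h : IsMartingaleDifference μ F X q) (k : ℕ) :
    Integrable (X k) μ :=
  ((h.memLp_four k).mono_exponent (by norm_num)).integrable le_rfl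

/-- Conditional Jensen without conditional expectations: test X² against Y = q, which gives E q² = E
qX², and use 2qX² ≤ q² + X⁴. Boundedness of q makes it an admissible test function. -/
lemma integral_condVar_sq_le (h : IsMartingaleDifference μ F X q) (k : ℕ) {C : ℝ}
    (hC : ∀ ω, q k ω ≤ C) : ∫ ω, q k ω ^ 2 ∂μ ≤ ∫ ω, X k ω ^ 4 ∂μ := by
  have hq := h.measurable_q k
  have hC' : ∀ ω, |q k ω| ≤ C := fun ω => by
    rw [abs_of_nonneg (h.condVar_nonneg k ω)]; exact hC ω
  have e := h.integral_real_mul_sq k (h.measurable_condVar k) hC'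
  have i1 : Integrable (fun ω => q k ω ^ 2) μ :=
    (MemLp.of_bound hq.aestronglyMeasurable C (ae_of_all _ hC')).integrable_sq
  have i2 : Integrable (fun ω => q k ω * X k ω ^ 2) μ :=
    (h.integrable_sq k).bdd_mul hq.aestronglyMeasurable (c := C) (ae_of_all _ hC')
  have : ∫ ω, q k ω * X k ω ^ 2 ∂μ ≤ ∫ ω, (q k ω ^ 2 + X k ω ^ 4) / 2 ∂μ := by
    refine integral_mono i2 ((i1.add (h.integrable_pow_four k)).div_const 2) fun ω => ?_
    have := sq_nonneg (q k ω - X k ω ^ 2)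
    simp only
    nlinarith
  rw [integral_div, integral_add i1 (h.integrable_pow_four k), e] at this
  have e2 : ∫ ω, q k ω * q k ω ∂μ = ∫ ω, q k ω ^ 2 ∂μ := by simp only [sq]
  linarith

/-- In the expansion of exp(itX) the linear term integrates to zero and X² may be replaced by q.
What remains is Z(exp(a)(1 - a) - 1) with a = t²q/2, which is of order q², plus the cubic remainder
r. -/
lemma norm_integral_mul_exp_sub_le (h : IsMartingaleDifference μ F X q) (k : ℕ) (t : ℝ)
    {δ : ℝ} (hδ : 0 < δ) {Z : Ω → ℂ} (hZ : Measurable[F k] Z) {M : ℝ}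
    (hM : ∀ ω, ‖Z ω‖ * Real.exp (t ^ 2 * q k ω / 2) ≤ M) {C : ℝ} (hC : ∀ ω, q k ω ≤ C) :
    ‖∫ ω, Z ω * (Complex.exp ((t ^ 2 * q k ω / 2 : ℝ) : ℂ) * Complex.exp ((t * X k ω : ℝ) * Complex.I))
      - Z ω ∂μ‖ ≤
      M * (t ^ 4 * ∫ ω, X k ω ^ 4 ∂μ) +
        4 * M * (δ * t ^ 2 * ∫ ω, q k ω ∂μ + t ^ 4 / δ * ∫ ω, X k ω ^ 4 ∂μ) := by
  have hX := h.measurable k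
  have hq := h.measurable_q k
  have hZm : Measurable Z := hZ.mono (h.le k) le_rfl
  have hq0 := h.condVar_nonneg k
  have hM0 : 0 ≤ M := by
    obtain ⟨ω⟩ : Nonempty Ω := μ.nonempty_of_neZero
    exact le_trans (by positivity) (hM ω)
  set Y : Ω → ℂ := fun ω => Z ω * Complex.exp ((t ^ 2 * q k ω / 2 : ℝ) : ℂ) with hYdef
  have hYF : Measurable[F k] Y := by
    refine hZ.mul (Complex.measurable_exp.comp (Complex.measurable_ofReal.comp ?_))
    exact ((h.measurable_condVar k).const_mul _).div_const _
  have hYm : Measurable Y := hYF.mono (h.le k) le_rfl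
  have hYM : ∀ ω, ‖Y ω‖ ≤ M := fun ω => by
    refine le_trans (le_of_eq ?_) (hM ω)
    rw [hYdef]
    simp only [norm_mul, Complex.norm_exp_ofReal]
  have hZM : ∀ ω, ‖Z ω‖ ≤ M := fun ω => by
    refine le_trans ?_ (hM ω)
    have : 1 ≤ Real.exp (t ^ 2 * q k ω / 2) := Real.one_le_exp (by have := hq0 ω; positivity)
    nlinarith [norm_nonneg (Z ω)]
  set a : Ω → ℝ := fun ω => t ^ 2 * q k ω / 2 with ha
  set r : Ω → ℂ := fun ω => Complex.exp ((t * X k ω : ℝ) * Complex.I) -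
    (1 + (t * X k ω : ℝ) * Complex.I - ((t * X k ω) ^ 2 / 2 : ℝ)) with hr
  have iY : Integrable Y μ := (MemLp.of_bound hYm.aestronglyMeasurable M (ae_of_all _ hYM)).integrable
    le_top
  have iZ : Integrable Z μ := (MemLp.of_bound hZm.aestronglyMeasurable M (ae_of_all _ hZM)).integrable
    le_top
  have iYX : Integrable (fun ω => Y ω * (X k ω : ℂ)) μ :=
    (h.integrable_diff k).ofReal.bdd_mul hYm.aestronglyMeasurable (c := M) (ae_of_all _ hYM)
  have iYX2 : Integrable (fun ω => Y ω * ((X k ω ^ 2 : ℝ) : ℂ)) μ :=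
    (h.integrable_sq k).ofReal.bdd_mul hYm.aestronglyMeasurable (c := M) (ae_of_all _ hYM)
  have iYq : Integrable (fun ω => Y ω * (q k ω : ℂ)) μ :=
    (h.integrable_condVar k).ofReal.bdd_mul hYm.aestronglyMeasurable (c := M) (ae_of_all _ hYM)
  have iq2 : Integrable (fun ω => q k ω ^ 2) μ :=
    (MemLp.of_bound hq.aestronglyMeasurable C (ae_of_all _ fun ω => by
      rw [Real.norm_of_nonneg (hq0 ω)]; exact hC ω)).integrable_sq
  have iE : Integrable (fun ω => Y ω * Complex.exp ((t * X k ω : ℝ) * Complex.I)) μ := by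
    refine (MemLp.of_bound (by fun_prop) M (ae_of_all _ fun ω => ?_)).integrable (le_top (a := 1))
    rw [norm_mul, Complex.norm_exp_ofReal_mul_I, mul_one]
    exact hYM ω
  have iA : Integrable (fun ω => Y ω * (1 - (a ω : ℂ)) - Z ω) μ := by
    have : (fun ω => Y ω * (1 - (a ω : ℂ)) - Z ω) =
        fun ω => (Y ω - (t ^ 2 / 2 : ℂ) * (Y ω * (q k ω : ℂ))) - Z ω := by
      ext ω; simp only [ha]; push_cast; ring
    rw [this]
    exact (iY.sub (iYq.const_mul _)).sub iZ
  have iR : Integrable (fun ω => Y ω * r ω) μ := by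
    have : (fun ω => Y ω * r ω) = fun ω => Y ω * Complex.exp ((t * X k ω : ℝ) * Complex.I) -
        (Y ω + (t * Complex.I) * (Y ω * (X k ω : ℂ)) - (t ^ 2 / 2 : ℂ) * (Y ω * ((X k ω ^ 2 : ℝ) : ℂ))) := by
      ext ω; simp only [hr]; push_cast; ring
    rw [this]
    exact iE.sub ((iY.add (iYX.const_mul _)).sub (iYX2.const_mul _))
  have key : ∫ ω, Z ω * (Complex.exp ((t ^ 2 * q k ω / 2 : ℝ) : ℂ) *
      Complex.exp ((t * X k ω : ℝ) * Complex.I)) - Z ω ∂μ =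
      (∫ ω, Y ω * (1 - (a ω : ℂ)) - Z ω ∂μ) + ∫ ω, Y ω * r ω ∂μ := by
    have e1 : ∀ ω, Z ω * (Complex.exp ((t ^ 2 * q k ω / 2 : ℝ) : ℂ) *
        Complex.exp ((t * X k ω : ℝ) * Complex.I)) - Z ω =
        ((Y ω * (1 - (a ω : ℂ)) - Z ω) + Y ω * r ω) + ((t * Complex.I) * (Y ω * (X k ω : ℂ)) -
          ((t ^ 2 / 2 : ℂ) * (Y ω * ((X k ω ^ 2 : ℝ) : ℂ)) - (t ^ 2 / 2 : ℂ) * (Y ω * (q k ω : ℂ)))) := by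
      intro ω
      simp only [hYdef, ha, hr]
      push_cast
      ring
    have iYXq : Integrable (fun ω => (t ^ 2 / 2 : ℂ) * (Y ω * ((X k ω ^ 2 : ℝ) : ℂ)) -
        (t ^ 2 / 2 : ℂ) * (Y ω * (q k ω : ℂ))) μ := (iYX2.const_mul _).sub (iYq.const_mul _)
    have iAR : Integrable (fun ω => (Y ω * (1 - (a ω : ℂ)) - Z ω) + Y ω * r ω) μ := iA.add iR
    simp_rw [e1]
    rw [integral_add iAR, integral_add iA iR,
      integral_sub (iYX.const_mul _) iYXq,
      integral_sub (iYX2.const_mul _) (iYq.const_mul _), integral_const_mul, integral_const_mul,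
      integral_const_mul, h.integral_mul k Y hYF ⟨M, hYM⟩, h.integral_mul_sq k Y hYF ⟨M, hYM⟩]
    · simp
    exact (iYX.const_mul _).sub iYXq
  rw [key]
  refine (norm_add_le _ _).trans (add_le_add ?_ ?_)
  · have b1 : ∀ ω, ‖Y ω * (1 - (a ω : ℂ)) - Z ω‖ ≤ M * (t ^ 4 * q k ω ^ 2) := by
      intro ω
      have e : Y ω * (1 - (a ω : ℂ)) - Z ω = Z ω * ((Real.exp (a ω) * (1 - a ω) - 1 : ℝ) : ℂ) := by
        simp only [hYdef, ha]; push_cast; ring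
      have ha0 : 0 ≤ a ω := by have := hq0 ω; simp only [ha]; positivity
      rw [e, norm_mul, Complex.norm_real, Real.norm_eq_abs]
      calc ‖Z ω‖ * |Real.exp (a ω) * (1 - a ω) - 1| ≤ ‖Z ω‖ * (Real.exp (a ω) * a ω ^ 2) := by
            gcongr; exact abs_exp_mul_one_sub_sub_one_le ha0
        _ = (‖Z ω‖ * Real.exp (a ω)) * a ω ^ 2 := by ring
        _ ≤ M * (t ^ 4 * q k ω ^ 2) := by
            gcongr
            · exact hM ω
            · simp only [ha]
              have : 0 ≤ t ^ 4 * q k ω ^ 2 := by positivity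
              nlinarith
    calc _ ≤ ∫ ω, M * (t ^ 4 * q k ω ^ 2) ∂μ :=
          norm_integral_le_of_norm_le ((iq2.const_mul _).const_mul _) (ae_of_all _ b1)
      _ = M * (t ^ 4 * ∫ ω, q k ω ^ 2 ∂μ) := by rw [integral_const_mul, integral_const_mul]
      _ ≤ _ := mul_le_mul_of_nonneg_left
          (mul_le_mul_of_nonneg_left (h.integral_condVar_sq_le k hC) (by positivity)) hM0
  · have b2 : ∀ ω, ‖Y ω * r ω‖ ≤
        4 * M * (δ * t ^ 2 * X k ω ^ 2 + t ^ 4 / δ * X k ω ^ 4) := by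
      intro ω
      rw [norm_mul]
      calc ‖Y ω‖ * ‖r ω‖ ≤ M * (4 * |t * X k ω| ^ 3) := by
            gcongr
            · exact hYM ω
            · exact norm_exp_mul_I_sub_taylor_le _
        _ ≤ M * (4 * (δ * (t * X k ω) ^ 2 + (t * X k ω) ^ 4 / δ)) := by
            gcongr; exact abs_pow_three_le _ hδ
        _ = _ := by ring
    calc _ ≤ ∫ ω, 4 * M * (δ * t ^ 2 * X k ω ^ 2 + t ^ 4 / δ * X k ω ^ 4) ∂μ :=
          norm_integral_le_of_norm_le ((((h.integrable_sq k).const_mul _).add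
            ((h.integrable_pow_four k).const_mul _)).const_mul _) (ae_of_all _ b2)
      _ = _ := by
          rw [integral_const_mul, integral_add ((h.integrable_sq k).const_mul _)
            ((h.integrable_pow_four k).const_mul _), integral_const_mul, integral_const_mul,
            h.integral_sq k]

/-- Telescope the expectations of exp(itS_k + t²V_k/2), starting from 1 at k = 0. The bound V_k ≤ 2
keeps the modulus below exp(t²) and the total variance below 2. -/
lemma norm_integral_exp_sub_one_le (h : IsMartingaleDifference μ F X q) (t : ℝ)
    {δ : ℝ} (hδ : 0 < δ) (hV : ∀ k ω, ∑ j ∈ Finset.range k, q j ω ≤ 2) (n : ℕ) :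
    ‖∫ ω, Complex.exp ((t * ∑ k ∈ Finset.range n, X k ω : ℝ) * Complex.I) *
        Complex.exp ((t ^ 2 * (∑ k ∈ Finset.range n, q k ω) / 2 : ℝ) : ℂ) ∂μ - 1‖ ≤
      Real.exp (t ^ 2) * (t ^ 4 * ∑ k ∈ Finset.range n, ∫ ω, X k ω ^ 4 ∂μ) +
        4 * Real.exp (t ^ 2) * (δ * t ^ 2 * 2 +
          t ^ 4 / δ * ∑ k ∈ Finset.range n, ∫ ω, X k ω ^ 4 ∂μ) := by
  have hq0 := h.condVar_nonneg
  set Z : ℕ → Ω → ℂ := fun n ω => Complex.exp ((t * ∑ k ∈ Finset.range n, X k ω : ℝ) * Complex.I) *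
        Complex.exp ((t ^ 2 * (∑ k ∈ Finset.range n, q k ω) / 2 : ℝ) : ℂ) with hZ
  have hZn : ∀ k ω, ‖Z k ω‖ = Real.exp (t ^ 2 * (∑ j ∈ Finset.range k, q j ω) / 2) := fun k ω => by
    simp only [hZ, norm_mul, Complex.norm_exp_ofReal_mul_I, Complex.norm_exp_ofReal, one_mul]
  have hZb : ∀ k ω, ‖Z k ω‖ ≤ Real.exp (t ^ 2) := fun k ω => by
    rw [hZn]
    apply Real.exp_le_exp.2
    nlinarith [hV k ω, sq_nonneg t]
  have hZm : ∀ k, Measurable[F k] (Z k) := fun k => by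
    have m1 : Measurable[F k] (fun ω => ∑ j ∈ Finset.range k, X j ω) :=
      Finset.measurable_fun_sum _ fun j hj =>
        (h.measurable_diff j).mono (h.mono (Finset.mem_range.1 hj)) le_rfl
    have m2 : Measurable[F k] (fun ω => ∑ j ∈ Finset.range k, q j ω) :=
      Finset.measurable_fun_sum _ fun j hj =>
        (h.measurable_condVar j).mono (h.mono (Finset.mem_range.1 hj).le) le_rfl
    refine Measurable.mul (Complex.measurable_exp.comp
      ((Complex.measurable_ofReal.comp (m1.const_mul _)).mul_const _))
      (Complex.measurable_exp.comp (Complex.measurable_ofReal.comp ((m2.const_mul _).div_const _)))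
  have hZi : ∀ k, Integrable (Z k) μ := fun k =>
    (MemLp.of_bound ((hZm k).mono (h.le k) le_rfl).aestronglyMeasurable _
      (ae_of_all _ (hZb k))).integrable (le_top (a := 1))
  have step : ∀ k, ‖∫ ω, Z (k + 1) ω ∂μ - ∫ ω, Z k ω ∂μ‖ ≤
      Real.exp (t ^ 2) * (t ^ 4 * ∫ ω, X k ω ^ 4 ∂μ) + 4 * Real.exp (t ^ 2) *
        (δ * t ^ 2 * ∫ ω, q k ω ∂μ + t ^ 4 / δ * ∫ ω, X k ω ^ 4 ∂μ) := fun k => by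
    rw [← integral_sub (hZi _) (hZi _)]
    have e : ∀ ω, Z (k + 1) ω - Z k ω = Z k ω * (Complex.exp ((t ^ 2 * q k ω / 2 : ℝ) : ℂ) *
        Complex.exp ((t * X k ω : ℝ) * Complex.I)) - Z k ω := fun ω => by
      simp only [hZ, Finset.sum_range_succ, ← Complex.exp_add]
      congr 2
      push_cast
      ring
    simp_rw [e]
    -- The modulus of Z k times exp(t² q k / 2) is exp(t² V_{k+1} / 2), so the bound on V at k + 1
    -- is the one used.
    refine h.norm_integral_mul_exp_sub_le k t hδ (hZm k) (M := Real.exp (t ^ 2)) (fun ω => ?_)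
      (C := 2) (fun ω => ?_)
    · rw [hZn, ← Real.exp_add]
      apply Real.exp_le_exp.2
      have := hV (k + 1) ω
      rw [Finset.sum_range_succ] at this
      nlinarith [sq_nonneg t]
    · have := hV (k + 1) ω
      rw [Finset.sum_range_succ] at this
      have := Finset.sum_nonneg fun j (_ : j ∈ Finset.range k) => hq0 j ω
      linarith
  have h0 : ∫ ω, Z 0 ω ∂μ = 1 := by simp [hZ]
  have tel : ∫ ω, Z n ω ∂μ - 1 = ∑ k ∈ Finset.range n, (∫ ω, Z (k + 1) ω ∂μ - ∫ ω, Z k ω ∂μ) := by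
    rw [Finset.sum_range_sub (fun k => ∫ ω, Z k ω ∂μ), h0]
  rw [tel]
  refine (norm_sum_le _ _).trans ((Finset.sum_le_sum fun k _ => step k).trans ?_)
  have hs : ∑ k ∈ Finset.range n, ∫ ω, q k ω ∂μ ≤ 2 := by
    rw [← integral_finsetSum _ fun k _ => h.integrable_condVar k]
    refine (integral_mono (integrable_finsetSum _ fun k _ => h.integrable_condVar k)
      (integrable_const 2) (hV n)).trans ?_
    simp
  rw [Finset.sum_add_distrib, ← Finset.mul_sum, ← Finset.mul_sum, ← Finset.mul_sum,
    Finset.sum_add_distrib, ← Finset.mul_sum, ← Finset.mul_sum]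
  gcongr

/-- A quantitative martingale central limit theorem for characteristic functions. -/
theorem norm_integral_exp_sub_le (h : IsMartingaleDifference μ F X q) (t : ℝ)
    {δ : ℝ} (hδ : 0 < δ) (n : ℕ) :
    ‖∫ ω, Complex.exp ((t * ∑ k ∈ Finset.range n, X k ω : ℝ) * Complex.I) ∂μ -
        Complex.exp (-t ^ 2 / 2)‖ ≤
      (1 + (1 + t ^ 2) * Real.exp (t ^ 2)) * ∫ ω, |∑ k ∈ Finset.range n, q k ω - 1| ∂μ +
      (Real.exp (t ^ 2) * (t ^ 4 * ∑ k ∈ Finset.range n, ∫ ω, X k ω ^ 4 ∂μ) +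
        4 * Real.exp (t ^ 2) * (δ * t ^ 2 * 2 +
          t ^ 4 / δ * ∑ k ∈ Finset.range n, ∫ ω, X k ω ^ 4 ∂μ)) := by
  have hq0 := h.condVar_nonneg
  have hs := h.stopped
  set I : ℕ → Set Ω := fun k => {ω | ∑ j ∈ Finset.range (k + 1), q j ω ≤ 2} with hI
  set X' : ℕ → Ω → ℝ := fun k => (I k).indicator (X k) with hX'
  set q' : ℕ → Ω → ℝ := fun k => (I k).indicator (q k) with hq'
  have hle : ∀ k ω, ∑ j ∈ Finset.range k, q' j ω ≤ ∑ j ∈ Finset.range k, q j ω := fun k ω =>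
    Finset.sum_le_sum fun j _ => Set.indicator_le_self' (fun _ _ => hq0 j _) ω
  -- Either the k-th term is kept, and then even the unstopped sum through k is at most 2, or it is
  -- zero.
  have hV : ∀ k ω, ∑ j ∈ Finset.range k, q' j ω ≤ 2 := by
    intro k ω
    induction k with
    | zero => simp
    | succ k ih =>
      by_cases hk : ω ∈ I k
      · exact (hle (k + 1) ω).trans hk
      · rw [Finset.sum_range_succ]
        simpa [hq', hk] using ih
  have heq : ∀ ω, ∑ j ∈ Finset.range n, q j ω ≤ 2 → ∀ j ∈ Finset.range n, ω ∈ I j := by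
    intro ω hω j hj
    refine le_trans (Finset.sum_le_sum_of_subset_of_nonneg ?_ fun i _ _ => hq0 i ω) hω
    exact Finset.range_subset_range.2 (Finset.mem_range.1 hj)
  have main := hs.norm_integral_exp_sub_one_le t hδ hV n
  have hL : ∑ k ∈ Finset.range n, ∫ ω, X' k ω ^ 4 ∂μ ≤ ∑ k ∈ Finset.range n, ∫ ω, X k ω ^ 4 ∂μ := by
    refine Finset.sum_le_sum fun k _ => integral_mono (hs.integrable_pow_four k)
      (h.integrable_pow_four k) fun ω => ?_
    by_cases hω : ω ∈ I k
    · simp [hX', hω]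
    · have : 0 ≤ X k ω ^ 4 := by positivity
      simpa [hX', Set.indicator_of_notMem hω] using this
  set Z : Ω → ℂ := fun ω => Complex.exp ((t * ∑ k ∈ Finset.range n, X' k ω : ℝ) * Complex.I) *
        Complex.exp ((t ^ 2 * (∑ k ∈ Finset.range n, q' k ω) / 2 : ℝ) : ℂ) with hZ
  set E : Ω → ℂ := fun ω => Complex.exp ((t * ∑ k ∈ Finset.range n, X k ω : ℝ) * Complex.I) with hE
  have mX := h.measurable
  have mq := h.measurable_q
  have mX' := hs.measurable
  have mq' := hs.measurable_q
  have iE : Integrable E μ :=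
    (MemLp.of_bound (by fun_prop) 1 (ae_of_all _ fun ω => by
      rw [Complex.norm_exp_ofReal_mul_I])).integrable (le_top (a := 1))
  have hZn : ∀ ω, ‖Z ω‖ = Real.exp (t ^ 2 * (∑ j ∈ Finset.range n, q' j ω) / 2) := fun ω => by
    simp only [hZ, norm_mul, Complex.norm_exp_ofReal_mul_I, Complex.norm_exp_ofReal, one_mul]
  have hZb : ∀ ω, ‖Z ω‖ ≤ Real.exp (t ^ 2) := fun ω => by
    rw [hZn]
    apply Real.exp_le_exp.2
    nlinarith [hV n ω, sq_nonneg t]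
  have mZ : Measurable Z := by fun_prop
  have iZ : Integrable Z μ := (MemLp.of_bound mZ.aestronglyMeasurable _
      (ae_of_all _ hZb)).integrable (le_top (a := 1))
  have iV : Integrable (fun ω => |∑ k ∈ Finset.range n, q k ω - 1|) μ :=
    ((integrable_finsetSum _ fun k _ => h.integrable_condVar k).sub (integrable_const 1)).abs
  set w : ℂ := Complex.exp (-t ^ 2 / 2) with hw
  have hwr : w = ((Real.exp (-t ^ 2 / 2) : ℝ) : ℂ) := by rw [hw]; push_cast; rfl
  have hwn : ‖w‖ ≤ 1 := by
    rw [hwr, Complex.norm_real, Real.norm_of_nonneg (Real.exp_pos _).le]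
    apply Real.exp_le_one_iff.2
    nlinarith [sq_nonneg t]
  have he1 : 1 ≤ Real.exp (t ^ 2) := Real.one_le_exp (sq_nonneg t)
  -- If V ≤ 2 nothing was stopped and E - wZ = E(1 - exp(t²(V - 1)/2)), which is Lipschitz in V - 1.
  -- If V > 2 then |V - 1| > 1 and the trivial bound suffices.
  have pt : ∀ ω, ‖E ω - w * Z ω‖ ≤ (1 + (1 + t ^ 2) * Real.exp (t ^ 2)) *
      |∑ k ∈ Finset.range n, q k ω - 1| := by
    intro ω
    rcases le_or_gt (∑ k ∈ Finset.range n, q k ω) 2 with hω | hω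
    · have hmem := heq ω hω
      have eX : ∑ k ∈ Finset.range n, X' k ω = ∑ k ∈ Finset.range n, X k ω :=
        Finset.sum_congr rfl fun k hk => Set.indicator_of_mem (hmem k hk) _
      have eq : ∑ k ∈ Finset.range n, q' k ω = ∑ k ∈ Finset.range n, q k ω :=
        Finset.sum_congr rfl fun k hk => Set.indicator_of_mem (hmem k hk) _
      set V := ∑ k ∈ Finset.range n, q k ω with hVdef
      have hV0 : 0 ≤ V := Finset.sum_nonneg fun k _ => hq0 k ω
      have e : E ω - w * Z ω = E ω * ((1 - Real.exp (t ^ 2 * (V - 1) / 2) : ℝ) : ℂ) := by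
        simp only [hZ, hE, eX, eq, hw]
        have : t ^ 2 * (V - 1) / 2 = -t ^ 2 / 2 + t ^ 2 * V / 2 := by ring
        rw [this, Real.exp_add]
        push_cast
        ring
      rw [e, norm_mul, Complex.norm_exp_ofReal_mul_I, one_mul, Complex.norm_real, Real.norm_eq_abs]
      set y := t ^ 2 * (V - 1) / 2 with hy
      have hyb : y ≤ t ^ 2 := by rw [hy]; nlinarith [sq_nonneg t]
      have hey : Real.exp y ≤ Real.exp (t ^ 2) := Real.exp_le_exp.2 hyb
      have h1 : |1 - Real.exp y| ≤ Real.exp (t ^ 2) * |y| := by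
        have l1 := Real.add_one_le_exp y
        have l2 : 1 - Real.exp y ≥ - (Real.exp y * y) := by
          have := Real.one_sub_le_exp_neg y
          have h4 : Real.exp y * Real.exp (-y) = 1 := by rw [← Real.exp_add]; simp
          nlinarith [Real.exp_pos y]
        have l3 : Real.exp y * y ≤ Real.exp (t ^ 2) * |y| :=
          (mul_le_mul_of_nonneg_left (le_abs_self y) (Real.exp_pos y).le).trans
            (mul_le_mul_of_nonneg_right hey (abs_nonneg y))
        have l4 : -y ≤ Real.exp (t ^ 2) * |y| := by
          nlinarith [neg_le_abs y, abs_nonneg y]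
        rw [abs_le]
        constructor <;> linarith
      refine h1.trans ?_
      rw [hy, abs_div, abs_mul, abs_of_nonneg (sq_nonneg t), abs_two]
      have := abs_nonneg (V - 1)
      have := Real.exp_pos (t ^ 2)
      have h5 : 0 ≤ t ^ 2 * Real.exp (t ^ 2) * |V - 1| := by positivity
      have h6 : 0 ≤ Real.exp (t ^ 2) * |V - 1| := by positivity
      nlinarith
    · have h1 : 1 ≤ |∑ k ∈ Finset.range n, q k ω - 1| := by
        rw [le_abs]; left; linarith
      have h2 : ‖E ω - w * Z ω‖ ≤ 1 + Real.exp (t ^ 2) := by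
        refine (norm_sub_le _ _).trans ?_
        rw [norm_mul, Complex.norm_exp_ofReal_mul_I]
        gcongr
        calc ‖w‖ * ‖Z ω‖ ≤ 1 * Real.exp (t ^ 2) := by gcongr; exact hZb ω
          _ = _ := one_mul _
      have h3 : 1 + Real.exp (t ^ 2) ≤ 1 + (1 + t ^ 2) * Real.exp (t ^ 2) := by
        nlinarith [sq_nonneg t]
      have h4 : 0 ≤ 1 + (1 + t ^ 2) * Real.exp (t ^ 2) := by positivity
      nlinarith
  have split : ∫ ω, E ω ∂μ - w = (∫ ω, (E ω - w * Z ω) ∂μ) + w * (∫ ω, Z ω ∂μ - 1) := by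
    rw [integral_sub iE (iZ.const_mul _), integral_const_mul]
    ring
  rw [split]
  refine (norm_add_le _ _).trans (add_le_add ?_ ?_)
  · refine (norm_integral_le_of_norm_le (iV.const_mul _) (ae_of_all _ pt)).trans_eq ?_
    rw [integral_const_mul]
  · rw [norm_mul]
    refine (mul_le_of_le_one_left (norm_nonneg _) hwn).trans (main.trans ?_)
    gcongr

end IsMartingaleDifference

end MartingaleDifferences

/-! ### Frobenius norms of Gram matrices. -/

section GramMatrices

variable {ι κ κ' : Type*} [Fintype ι] [Fintype κ] [Fintype κ']

/-- The squared Frobenius norm of the Gram matrix `H * Hᵀ`. -/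
def gramNormSq (H : Matrix ι κ ℝ) : ℝ := ∑ i, ∑ i', (∑ j, H i j * H i' j) ^ 2

lemma gramNormSq_eq_norm_sq (H : Matrix ι κ ℝ) : gramNormSq H = ‖H * Hᵀ‖ ^ 2 := by
  rw [Matrix.frobenius_norm_def, ← Real.sqrt_eq_rpow, Real.sq_sqrt (by positivity)]
  simp [gramNormSq, Matrix.mul_apply]

/-- Expanding the square and summing over j, j' first turns ‖H'DK‖_F² into a weighted entrywise
pairing of HH' with KK'. -/
lemma sum_sq_sum_weighted_mul_eq (D : ι → ℝ) (H : Matrix ι κ ℝ) (K : Matrix ι κ' ℝ) :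
    ∑ j, ∑ j', (∑ i, D i * H i j * K i j') ^ 2 =
      ∑ i, ∑ i', D i * D i' * ((∑ j, H i j * H i' j) * ∑ j', K i j' * K i' j') := by
  have h1 : ∀ j j', (∑ i, D i * H i j * K i j') ^ 2 =
      ∑ i, ∑ i', D i * D i' * ((H i j * H i' j) * (K i j' * K i' j')) := fun j j' => by
    rw [sq, Finset.sum_mul_sum]
    exact Finset.sum_congr rfl fun i _ => Finset.sum_congr rfl fun i' _ => by ring
  simp_rw [h1, Finset.sum_mul_sum, Finset.mul_sum]
  have h2 : ∀ j, ∑ j', ∑ i, ∑ i', D i * D i' * ((H i j * H i' j) * (K i j' * K i' j')) =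
      ∑ i, ∑ i', ∑ j', D i * D i' * ((H i j * H i' j) * (K i j' * K i' j')) := fun j => by
    rw [Finset.sum_comm]
    exact Finset.sum_congr rfl fun i _ => Finset.sum_comm
  simp_rw [h2]
  rw [Finset.sum_comm]
  exact Finset.sum_congr rfl fun i _ => Finset.sum_comm

lemma sum_sq_sum_weighted_mul_le (D : ι → ℝ) {c : ℝ} (hD : ∀ i, |D i| ≤ c) (H : Matrix ι κ ℝ)
    (K : Matrix ι κ' ℝ) :
    ∑ j, ∑ j', (∑ i, D i * H i j * K i j') ^ 2 ≤ c ^ 2 * (gramNormSq H + gramNormSq K) / 2 := by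
  have hr : c ^ 2 * (gramNormSq H + gramNormSq K) / 2 = ∑ i, ∑ i', c ^ 2 / 2 *
      ((∑ j, H i j * H i' j) ^ 2 + (∑ j', K i j' * K i' j') ^ 2) := by
    simp_rw [← Finset.mul_sum, Finset.sum_add_distrib, gramNormSq]
    ring
  rw [sum_sq_sum_weighted_mul_eq, hr]
  refine Finset.sum_le_sum fun i _ => Finset.sum_le_sum fun i' _ => ?_
  set x := ∑ j, H i j * H i' j
  set y := ∑ j', K i j' * K i' j'
  have h1 : |D i * D i'| ≤ c ^ 2 := by
    rw [abs_mul, sq]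
    exact mul_le_mul (hD i) (hD i') (abs_nonneg _) ((abs_nonneg _).trans (hD i))
  calc D i * D i' * (x * y) ≤ |D i * D i'| * |x * y| := by
        rw [← abs_mul]; exact le_abs_self _
    _ ≤ c ^ 2 * ((x ^ 2 + y ^ 2) / 2) := by
        gcongr
        rw [abs_le]
        constructor <;> nlinarith [sq_nonneg (x + y), sq_nonneg (x - y)]
    _ = _ := by ring

/-- The case D = 1, K = H of the preceding identity: H'H and HH' have the same Frobenius norm. -/
lemma gramNormSq_transpose (H : Matrix ι κ ℝ) : gramNormSq Hᵀ = gramNormSq H := by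
  have := sum_sq_sum_weighted_mul_eq (fun _ => 1) H H
  simp only [one_mul] at this
  simp only [gramNormSq, Matrix.transpose_apply, this]
  exact Finset.sum_congr rfl fun i _ => Finset.sum_congr rfl fun i' _ => by ring

lemma sum_sq_sum_mul_le (H K : Matrix ι κ ℝ) :
    ∑ i, ∑ i', (∑ j, H i j * K i' j) ^ 2 ≤ (gramNormSq H + gramNormSq K) / 2 := by
  have := sum_sq_sum_weighted_mul_le (fun _ => 1) (c := 1) (by simp) Hᵀ Kᵀ
  simpa [gramNormSq_transpose] using this

/-- The Gram matrix splits into four products. The square of a sum of four costs a factor 4, and the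
two mixed products HK', KH' together cost no more than the two pure ones, which doubles it to 8. -/
lemma gramNormSq_linear_comb_le (H K : Matrix ι κ ℝ) {a α β : ℝ} (hα : |α| ≤ a) (hβ : |β| ≤ a) :
    gramNormSq (fun i j => α * H i j + β * K i j) ≤
      8 * a ^ 4 * (gramNormSq H + gramNormSq K) := by
  have ha : 0 ≤ a := (abs_nonneg _).trans hα
  have hα2 : α ^ 2 ≤ a ^ 2 := by rw [← sq_abs]; gcongr
  have hβ2 : β ^ 2 ≤ a ^ 2 := by rw [← sq_abs]; gcongr
  have h1 : ∀ i i', (∑ j, (α * H i j + β * K i j) * (α * H i' j + β * K i' j)) ^ 2 ≤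
      4 * a ^ 4 * ((∑ j, H i j * H i' j) ^ 2 + (∑ j, H i j * K i' j) ^ 2 +
        (∑ j, K i j * H i' j) ^ 2 + (∑ j, K i j * K i' j) ^ 2) := by
    intro i i'
    have e : ∑ j, (α * H i j + β * K i j) * (α * H i' j + β * K i' j) =
        α ^ 2 * (∑ j, H i j * H i' j) + (α * β) * (∑ j, H i j * K i' j) +
        (α * β) * (∑ j, K i j * H i' j) + β ^ 2 * (∑ j, K i j * K i' j) := by
      simp_rw [Finset.mul_sum, ← Finset.sum_add_distrib]
      exact Finset.sum_congr rfl fun j _ => by ring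
    rw [e]
    set x := ∑ j, H i j * H i' j
    set y := ∑ j, H i j * K i' j
    set z := ∑ j, K i j * H i' j
    set w := ∑ j, K i j * K i' j
    have k1 : (α ^ 2) ^ 2 ≤ a ^ 4 := by
      calc (α ^ 2) ^ 2 ≤ (a ^ 2) ^ 2 := by gcongr
        _ = _ := by ring
    have k2 : (β ^ 2) ^ 2 ≤ a ^ 4 := by
      calc (β ^ 2) ^ 2 ≤ (a ^ 2) ^ 2 := by gcongr
        _ = _ := by ring
    have k3 : (α * β) ^ 2 ≤ a ^ 4 := by
      calc (α * β) ^ 2 = α ^ 2 * β ^ 2 := by ring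
        _ ≤ a ^ 2 * a ^ 2 := by gcongr
        _ = _ := by ring
    have q : ∀ p q r s : ℝ, (p + q + r + s) ^ 2 ≤ 4 * (p ^ 2 + q ^ 2 + r ^ 2 + s ^ 2) := by
      intro p q r s
      nlinarith [sq_nonneg (p - q), sq_nonneg (p - r), sq_nonneg (p - s), sq_nonneg (q - r),
        sq_nonneg (q - s), sq_nonneg (r - s)]
    refine (q _ _ _ _).trans ?_
    simp only [mul_pow _ x, mul_pow _ y, mul_pow _ z, mul_pow _ w]
    have := mul_le_mul_of_nonneg_right k1 (sq_nonneg x)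
    have := mul_le_mul_of_nonneg_right k3 (sq_nonneg y)
    have := mul_le_mul_of_nonneg_right k3 (sq_nonneg z)
    have := mul_le_mul_of_nonneg_right k2 (sq_nonneg w)
    linarith
  have h2 := sum_sq_sum_mul_le H K
  have h3 := sum_sq_sum_mul_le K H
  calc gramNormSq (fun i j => α * H i j + β * K i j)
      ≤ ∑ i, ∑ i', 4 * a ^ 4 * ((∑ j, H i j * H i' j) ^ 2 + (∑ j, H i j * K i' j) ^ 2 +
        (∑ j, K i j * H i' j) ^ 2 + (∑ j, K i j * K i' j) ^ 2) :=
        Finset.sum_le_sum fun i _ => Finset.sum_le_sum fun i' _ => h1 i i'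
    _ = 4 * a ^ 4 * (gramNormSq H + (∑ i, ∑ i', (∑ j, H i j * K i' j) ^ 2) +
        (∑ i, ∑ i', (∑ j, K i j * H i' j) ^ 2) + gramNormSq K) := by
        simp_rw [← Finset.mul_sum, Finset.sum_add_distrib, gramNormSq]
    _ ≤ 4 * a ^ 4 * (2 * (gramNormSq H + gramNormSq K)) := by gcongr; linarith
    _ = _ := by ring

/-- |H'r|² = r'HH'r is the Frobenius pairing of HH' with rr', and ‖rr'‖_F = |r|²; apply
Cauchy–Schwarz over pairs of indices. -/
lemma sum_sq_sum_weighted_le (r : ι → ℝ) (H : Matrix ι κ ℝ) :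
    ∑ j, (∑ i, r i * H i j) ^ 2 ≤ √(gramNormSq H) * ∑ i, r i ^ 2 := by
  have e : ∑ j, (∑ i, r i * H i j) ^ 2 = ∑ p : ι × ι, (∑ j, H p.1 j * H p.2 j) * (r p.1 * r p.2) := by
    rw [Fintype.sum_prod_type]
    have h1 : ∀ j, (∑ i, r i * H i j) ^ 2 = ∑ i, ∑ i', (H i j * H i' j) * (r i * r i') :=
      fun j => by
        rw [sq, Finset.sum_mul_sum]
        exact Finset.sum_congr rfl fun i _ => Finset.sum_congr rfl fun i' _ => by ring
    simp_rw [h1, Finset.sum_mul]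
    rw [Finset.sum_comm]
    exact Finset.sum_congr rfl fun i _ => Finset.sum_comm
  rw [e]
  refine (Real.sum_mul_le_sqrt_mul_sqrt _ _ _).trans_eq ?_
  congr 1
  · rw [Fintype.sum_prod_type, gramNormSq]
  · rw [Fintype.sum_prod_type]
    simp_rw [mul_pow]
    rw [← Finset.sum_mul_sum, Real.sqrt_mul_self (by positivity)]

/-- The left side keeps only the diagonal entries of HH'. -/
lemma sum_sq_sum_sq_le (H : Matrix ι κ ℝ) : ∑ i, (∑ j, H i j ^ 2) ^ 2 ≤ gramNormSq H := by
  refine Finset.sum_le_sum fun i _ => ?_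
  simp only [sq (H i _)]
  exact Finset.single_le_sum (f := fun i' => (∑ j, H i j * H i' j) ^ 2)
    (fun i' _ => sq_nonneg _) (Finset.mem_univ i)

end GramMatrices

/-! ### Independence of one vector from functions of the others. -/

section Independence

variable {Ω ι E : Type*} {m : MeasurableSpace Ω} [mE : MeasurableSpace E] {μ : Measure Ω}

/-- The σ-algebra generated by the variables `v j` with `j ∈ S`. -/
@[reducible] def generatedBy (v : ι → Ω → E) (S : Set ι) : MeasurableSpace Ω :=
  ⨆ j ∈ S, mE.comap (v j)

lemma generatedBy_le {v : ι → Ω → E} (hv : ∀ j, Measurable (v j)) (S : Set ι) :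
    generatedBy v S ≤ m :=
  iSup₂_le fun j _ => (hv j).comap_le

lemma generatedBy_mono (v : ι → Ω → E) {S T : Set ι} (h : S ⊆ T) :
    generatedBy v S ≤ generatedBy v T :=
  biSup_mono fun _ hj => h hj

lemma measurable_generatedBy (v : ι → Ω → E) {S : Set ι} {j : ι} (hj : j ∈ S) :
    Measurable[generatedBy v S] (v j) :=
  Measurable.of_comap_le (le_biSup (fun j => mE.comap (v j)) hj)

lemma indepFun_of_measurable_generatedBy {α β : Type*} [MeasurableSpace α] [MeasurableSpace β]
    {v : ι → Ω → E} (hv : ∀ j, Measurable (v j)) (hind : iIndepFun v μ) {S : Set ι} {a : ι}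
    (ha : a ∉ S) {f : Ω → α} (hf : Measurable[generatedBy v S] f) {φ : E → β}
    (hφ : Measurable φ) : IndepFun f (fun ω => φ (v a ω)) μ := by
  have h1 : Indep (generatedBy v S) (generatedBy v {a}) μ :=
    indep_iSup_of_disjoint (fun j => (hv j).comap_le) hind
      (Set.disjoint_singleton_right.2 ha)
  rw [IndepFun_iff_Indep]
  refine indep_of_indep_of_le_left (indep_of_indep_of_le_right h1 ?_) hf.comap_le
  exact (hφ.comp (measurable_generatedBy v (Set.mem_singleton a))).comap_le

end Independence

/-! ### Moments of linear and quadratic forms in independent variables. -/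

section Moments

variable {Ω : Type*} {m : MeasurableSpace Ω} {μ : Measure Ω}

lemma memLp_two_mul_of_memLp_four {f g : Ω → ℝ} (hf : MemLp f 4 μ) (hg : MemLp g 4 μ) :
    MemLp (fun ω => f ω * g ω) 2 μ := by
  have : ENNReal.HolderTriple 4 4 2 := ⟨by
    rw [← ENNReal.toReal_eq_toReal_iff' (by simp) (by simp)]
    rw [ENNReal.toReal_add (by simp) (by simp)]
    norm_num⟩
  exact hg.mul' hf

/-- The variance of f² is nonnegative. -/
lemma integral_sq_le_of_pow_four [IsProbabilityMeasure μ] {f : Ω → ℝ} (hf : MemLp f 4 μ) {κ : ℝ}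
    (hκ : 0 ≤ κ) (h : ∫ ω, f ω ^ 4 ∂μ ≤ κ ^ 2) : ∫ ω, f ω ^ 2 ∂μ ≤ κ := by
  have h2 : MemLp (fun ω => f ω ^ 2) 2 μ := by
    simpa only [sq] using memLp_two_mul_of_memLp_four hf hf
  have h3 := variance_nonneg (fun ω => f ω ^ 2) μ
  rw [variance_eq_sub h2] at h3
  have h4 : ∫ ω, ((fun ω => f ω ^ 2) ^ 2) ω ∂μ = ∫ ω, f ω ^ 4 ∂μ := by
    congr 1 with ω
    simp only [Pi.pow_apply]
    ring
  rw [h4] at h3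
  exact abs_le_of_sq_le_sq' (by linarith) hκ |>.2

lemma integral_mul_sq_le_of_pow_four {f g : Ω → ℝ} (hf : MemLp f 4 μ)
    (hg : MemLp g 4 μ) (mf : Measurable f) (mg : Measurable g) {c : ℝ}
    (h : ∫ ω, f ω ^ 4 ∂μ ≤ c) (h' : ∫ ω, g ω ^ 4 ∂μ ≤ c) :
    ∫ ω, (f ω * g ω) ^ 2 ∂μ ≤ c := by
  have i1 := (memLp_four_iff_integrable_pow mf).1 hf
  have i2 := (memLp_four_iff_integrable_pow mg).1 hg
  have : ∫ ω, (f ω * g ω) ^ 2 ∂μ ≤ ∫ ω, (f ω ^ 4 + g ω ^ 4) / 2 ∂μ := by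
    refine integral_mono (memLp_two_mul_of_memLp_four hf hg).integrable_sq
      ((i1.add i2).div_const 2) fun ω => ?_
    have := sq_nonneg (f ω ^ 2 - g ω ^ 2)
    simp only
    nlinarith
  rw [integral_div, integral_add i1 i2] at this
  linarith

/-- Independence lets second moments multiply; Hölder alone would place the product only in L¹. -/
lemma ProbabilityTheory.IndepFun.memLp_two_mul {f g : Ω → ℝ} (h : IndepFun f g μ)
    (hf : MemLp f 2 μ) (hg : MemLp g 2 μ) : MemLp (fun ω => f ω * g ω) 2 μ := by
  rw [memLp_two_iff_integrable_sq (show AEStronglyMeasurable (fun ω => f ω * g ω) μ from hf.1.mul hg.1)]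
  have := (h.comp (measurable_id.pow_const 2) (measurable_id.pow_const 2)).integrable_mul
    hf.integrable_sq hg.integrable_sq
  convert! this using 2 with ω
  simp [mul_pow]

lemma ProbabilityTheory.IndepFun.integral_mul_pow {f g : Ω → ℝ} (h : IndepFun f g μ)
    (hf : Measurable f) (hg : Measurable g) (p : ℕ) :
    ∫ ω, (f ω * g ω) ^ p ∂μ = (∫ ω, f ω ^ p ∂μ) * ∫ ω, g ω ^ p ∂μ := by
  simp_rw [mul_pow]
  exact (h.comp (measurable_id.pow_const p) (measurable_id.pow_const p)).integral_fun_mul_eq_mul_integral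
    (hf.pow_const p).aestronglyMeasurable (hg.pow_const p).aestronglyMeasurable

lemma memLp_sum_mul {ι : Type*} {x : ι → Ω → ℝ} {p : ENNReal} (h : ∀ j, MemLp (x j) p μ) (S : Finset ι)
    (c : ι → ℝ) : MemLp (fun ω => ∑ j ∈ S, c j * x j ω) p μ :=
  memLp_finsetSum _ fun j _ => (h j).const_mul _

variable {ι E : Type*} [MeasurableSpace E] [IsProbabilityMeasure μ]

/-- Second and fourth moments of a linear combination of independent centered variables. -/
lemma integral_sum_mul_moments_le {v : ι → Ω → E} (hv : ∀ j, Measurable (v j))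
    (hind : iIndepFun v μ) {f : E → ℝ} (hf : Measurable f)
    (h4 : ∀ j, MemLp (fun ω => f (v j ω)) 4 μ) (h0 : ∀ j, ∫ ω, f (v j ω) ∂μ = 0) {κ : ℝ}
    (hκ : 0 ≤ κ) (hm : ∀ j, ∫ ω, f (v j ω) ^ 4 ∂μ ≤ κ ^ 2) (S : Finset ι) (c : ι → ℝ) :
    ∫ ω, (∑ j ∈ S, c j * f (v j ω)) ^ 2 ∂μ ≤ κ * ∑ j ∈ S, c j ^ 2 ∧
    ∫ ω, (∑ j ∈ S, c j * f (v j ω)) ^ 4 ∂μ ≤ 3 * (κ * ∑ j ∈ S, c j ^ 2) ^ 2 := by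
  classical
  induction S using Finset.induction_on with
  | empty => simp
  | insert a S ha ih =>
    obtain ⟨ih2, ih4⟩ := ih
    set L : Ω → ℝ := fun ω => ∑ j ∈ S, c j * f (v j ω) with hL
    set x : Ω → ℝ := fun ω => c a * f (v a ω) with hx
    have mL : Measurable[generatedBy v (S : Set ι)] L := Finset.measurable_fun_sum _ fun j hj =>
      (hf.comp (measurable_generatedBy v (S := (S : Set ι)) hj)).const_mul _
    have mL' : Measurable L := mL.mono (generatedBy_le hv _) le_rfl
    have mx : Measurable x := (hf.comp (hv a)).const_mul _
    have ind : IndepFun L x μ := indepFun_of_measurable_generatedBy hv hind (S := (S : Set ι))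
      (by simpa using ha) mL (φ := fun e => c a * f e) (hf.const_mul _)
    have L4 : MemLp L 4 μ := memLp_sum_mul h4 S c
    have x4 : MemLp x 4 μ := (h4 a).const_mul _
    have L2 : MemLp L 2 μ := L4.mono_exponent (by norm_num)
    have x2 : MemLp x 2 μ := x4.mono_exponent (by norm_num)
    have hx0 : ∫ ω, x ω ∂μ = 0 := by simp only [hx, integral_const_mul, h0, mul_zero]
    have hx4 : ∫ ω, x ω ^ 4 ∂μ ≤ (κ * c a ^ 2) ^ 2 := by
      simp only [hx, mul_pow, integral_const_mul]
      calc c a ^ 4 * ∫ ω, f (v a ω) ^ 4 ∂μ ≤ c a ^ 4 * κ ^ 2 := by gcongr; exact hm a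
        _ = _ := by ring
    have hx2 : ∫ ω, x ω ^ 2 ∂μ ≤ κ * c a ^ 2 := integral_sq_le_of_pow_four x4 (by positivity) hx4
    have hL0 : 0 ≤ ∫ ω, L ω ^ 2 ∂μ := by positivity
    have hx20 : 0 ≤ ∫ ω, x ω ^ 2 ∂μ := by positivity
    have mixed : ∀ p r : ℕ, ∫ ω, L ω ^ p * x ω ^ r ∂μ = (∫ ω, L ω ^ p ∂μ) * ∫ ω, x ω ^ r ∂μ :=
      fun p r => (ind.comp (measurable_id.pow_const p)
        (measurable_id.pow_const r)).integral_fun_mul_eq_mul_integral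
        (mL'.pow_const p).aestronglyMeasurable (mx.pow_const r).aestronglyMeasurable
    have sqL : MemLp (fun ω => L ω ^ 2) 2 μ := by
      simpa only [sq] using memLp_two_mul_of_memLp_four L4 L4
    have sqx : MemLp (fun ω => x ω ^ 2) 2 μ := by
      simpa only [sq] using memLp_two_mul_of_memLp_four x4 x4
    have mulLx := memLp_two_mul_of_memLp_four L4 x4
    simp only [Finset.sum_insert ha]
    set B := ∑ j ∈ S, c j ^ 2
    have hB : 0 ≤ B := Finset.sum_nonneg fun j _ => sq_nonneg _
    constructor
    · have e : ∀ ω, (x ω + L ω) ^ 2 = x ω ^ 2 + L ω ^ 2 + 2 * (L ω ^ 1 * x ω ^ 1) := fun ω => by ring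
      have i1 : Integrable (fun ω => x ω ^ 2 + L ω ^ 2) μ := x2.integrable_sq.add L2.integrable_sq
      have i2 : Integrable (fun ω => 2 * (L ω ^ 1 * x ω ^ 1)) μ := by
        simpa only [pow_one] using! (L2.integrable_mul x2).const_mul 2
      calc ∫ ω, (x ω + L ω) ^ 2 ∂μ = ∫ ω, x ω ^ 2 ∂μ + ∫ ω, L ω ^ 2 ∂μ := by
            simp_rw [e]
            rw [integral_add i1 i2, integral_add x2.integrable_sq L2.integrable_sq,
              integral_const_mul, mixed]
            simp [hx0]
        _ ≤ _ := by linarith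
    · have e : ∀ ω, (x ω + L ω) ^ 4 = x ω ^ 4 + L ω ^ 4 + 6 * (L ω ^ 2 * x ω ^ 2) +
          4 * (L ω ^ 3 * x ω ^ 1) + 4 * (L ω ^ 1 * x ω ^ 3) := fun ω => by ring
      have ix4 := (memLp_four_iff_integrable_pow mx).1 x4
      have iL4 := (memLp_four_iff_integrable_pow mL').1 L4
      have i1 : Integrable (fun ω => 6 * (L ω ^ 2 * x ω ^ 2)) μ :=
        (sqL.integrable_mul sqx).const_mul 6
      have i2 : Integrable (fun ω => 4 * (L ω ^ 3 * x ω ^ 1)) μ := by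
        refine (Integrable.congr (sqL.integrable_mul mulLx) (ae_of_all _ fun ω => ?_)).const_mul 4
        simp only [Pi.mul_apply]
        ring
      have i3 : Integrable (fun ω => 4 * (L ω ^ 1 * x ω ^ 3)) μ := by
        refine (Integrable.congr (sqx.integrable_mul mulLx) (ae_of_all _ fun ω => ?_)).const_mul 4
        simp only [Pi.mul_apply]
        ring
      have j0 : Integrable (fun ω => x ω ^ 4 + L ω ^ 4) μ := ix4.add iL4
      have j1 : Integrable (fun ω => x ω ^ 4 + L ω ^ 4 + 6 * (L ω ^ 2 * x ω ^ 2)) μ := j0.add i1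
      have j2 : Integrable (fun ω => x ω ^ 4 + L ω ^ 4 + 6 * (L ω ^ 2 * x ω ^ 2) +
          4 * (L ω ^ 3 * x ω ^ 1)) μ := j1.add i2
      calc ∫ ω, (x ω + L ω) ^ 4 ∂μ = ∫ ω, x ω ^ 4 ∂μ + ∫ ω, L ω ^ 4 ∂μ +
            6 * ((∫ ω, L ω ^ 2 ∂μ) * ∫ ω, x ω ^ 2 ∂μ) := by
            simp_rw [e]
            rw [integral_add j2 i3, integral_add j1 i2, integral_add j0 i1,
              integral_add ix4 iL4, integral_const_mul, integral_const_mul, integral_const_mul,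
              mixed, mixed, mixed]
            simp only [pow_one, hx0, mul_zero, add_zero]
            -- Of the odd terms, L³x vanishes because x is centered, but Lx³ needs L to be centered.
            have : ∫ ω, L ω ∂μ = 0 := by
              simp only [hL]
              rw [integral_finsetSum _ fun j _ => ((h4 j).const_mul _).integrable (by norm_num)]
              simp [integral_const_mul, h0]
            simp [this]
        _ ≤ (κ * c a ^ 2) ^ 2 + 3 * (κ * B) ^ 2 + 6 * ((κ * B) * (κ * c a ^ 2)) := by
            gcongr
        -- The constant 3 makes the induction close: 3(κ c² + κB)² produces exactly the cross term
        -- with coefficient 6.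
        _ ≤ _ := by
            have : 0 ≤ (κ * c a ^ 2) ^ 2 := by positivity
            nlinarith

/-- The variance of a quadratic form in independent centered variables. -/
lemma integral_sq_centered_quadratic_le {v : ι → Ω → E} (hv : ∀ j, Measurable (v j))
    (hind : iIndepFun v μ) {f g : E → ℝ} (hf : Measurable f) (hg : Measurable g)
    (f4 : ∀ j, MemLp (fun ω => f (v j ω)) 4 μ) (g4 : ∀ j, MemLp (fun ω => g (v j ω)) 4 μ)
    (f0 : ∀ j, ∫ ω, f (v j ω) ∂μ = 0) (g0 : ∀ j, ∫ ω, g (v j ω) ∂μ = 0) {κ : ℝ}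
    (hκ : 0 ≤ κ) (fm : ∀ j, ∫ ω, f (v j ω) ^ 4 ∂μ ≤ κ ^ 2)
    (gm : ∀ j, ∫ ω, g (v j ω) ^ 4 ∂μ ≤ κ ^ 2) (S : Finset ι) (M : ι → ι → ℝ) :
    ∫ ω, (∑ j ∈ S, ∑ k ∈ S, M j k *
      (f (v j ω) * g (v k ω) - ∫ ω', f (v j ω') * g (v k ω') ∂μ)) ^ 2 ∂μ ≤
      3 * κ ^ 2 * ∑ j ∈ S, ∑ k ∈ S, M j k ^ 2 := by
  classical
  have fg2 : ∀ j k, MemLp (fun ω => f (v j ω) * g (v k ω) - ∫ ω', f (v j ω') * g (v k ω') ∂μ) 2 μ :=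
    fun j k => (memLp_two_mul_of_memLp_four (f4 j) (g4 k)).sub (memLp_const _)
  induction S using Finset.induction_on with
  | empty => simp
  | insert a S ha ih =>
    set U : Ω → ℝ := fun ω => ∑ j ∈ S, ∑ k ∈ S, M j k *
      (f (v j ω) * g (v k ω) - ∫ ω', f (v j ω') * g (v k ω') ∂μ) with hU
    set L1 : Ω → ℝ := fun ω => ∑ k ∈ S, M a k * g (v k ω) with hL1
    set L2 : Ω → ℝ := fun ω => ∑ k ∈ S, M k a * f (v k ω) with hL2
    set ψ : E → ℝ := fun e => M a a * (f e * g e - ∫ ω', f (v a ω') * g (v a ω') ∂μ) with hψ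
    have haS : a ∉ (S : Set ι) := by simpa using ha
    have mfS : ∀ j ∈ S, Measurable[generatedBy v (S : Set ι)] (fun ω => f (v j ω)) := fun j hj =>
      hf.comp (measurable_generatedBy v (S := (S : Set ι)) hj)
    have mgS : ∀ j ∈ S, Measurable[generatedBy v (S : Set ι)] (fun ω => g (v j ω)) := fun j hj =>
      hg.comp (measurable_generatedBy v (S := (S : Set ι)) hj)
    have mU : Measurable[generatedBy v (S : Set ι)] U := Finset.measurable_fun_sum _ fun j hj =>
      Finset.measurable_fun_sum _ fun k hk => (((mfS j hj).mul (mgS k hk)).sub_const _).const_mul _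
    have mL1 : Measurable[generatedBy v (S : Set ι)] L1 := Finset.measurable_fun_sum _ fun k hk =>
      (mgS k hk).const_mul _
    have mL2 : Measurable[generatedBy v (S : Set ι)] L2 := Finset.measurable_fun_sum _ fun k hk =>
      (mfS k hk).const_mul _
    have mψ : Measurable ψ := ((hf.mul hg).sub_const _).const_mul _
    have amb : ∀ {h : Ω → ℝ}, Measurable[generatedBy v (S : Set ι)] h → Measurable h :=
      fun hh => hh.mono (generatedBy_le hv _) le_rfl
    have U2 : MemLp U 2 μ := memLp_finsetSum _ fun j _ => memLp_finsetSum _ fun k _ =>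
      (fg2 j k).const_mul _
    have L12 : MemLp L1 2 μ := memLp_sum_mul (fun k => (g4 k).mono_exponent (by norm_num)) S _
    have L22 : MemLp L2 2 μ := memLp_sum_mul (fun k => (f4 k).mono_exponent (by norm_num)) S _
    have fa2 : MemLp (fun ω => f (v a ω)) 2 μ := (f4 a).mono_exponent (by norm_num)
    have ga2 : MemLp (fun ω => g (v a ω)) 2 μ := (g4 a).mono_exponent (by norm_num)
    have ψ2 : MemLp (fun ω => ψ (v a ω)) 2 μ := (fg2 a a).const_mul _
    have indep : ∀ {h : Ω → ℝ} {φ : E → ℝ}, Measurable[generatedBy v (S : Set ι)] h →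
        Measurable φ → IndepFun h (fun ω => φ (v a ω)) μ :=
      fun hh hφ => indepFun_of_measurable_generatedBy hv hind haS hh hφ
    have orth : ∀ {h : Ω → ℝ} {φ : E → ℝ}, Measurable[generatedBy v (S : Set ι)] h →
        Measurable φ → ∫ ω, φ (v a ω) ∂μ = 0 → ∫ ω, h ω * φ (v a ω) ∂μ = 0 := by
      intro h φ hh hφ h0
      rw [(indep hh hφ).integral_fun_mul_eq_mul_integral (amb hh).aestronglyMeasurable
        (hφ.comp (hv a)).aestronglyMeasurable, h0, mul_zero]
    have ψ0 : ∫ ω, ψ (v a ω) ∂μ = 0 := by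
      simp only [hψ, integral_const_mul]
      rw [integral_sub ((memLp_two_mul_of_memLp_four (f4 a) (g4 a)).integrable (by norm_num))
        (integrable_const _)]
      simp
    have cross1 : ∀ k ∈ S, ∫ ω, f (v a ω) * g (v k ω) ∂μ = 0 := fun k hk => by
      simp_rw [mul_comm (f _)]
      exact orth (mgS k hk) hf (f0 a)
    have cross2 : ∀ k ∈ S, ∫ ω, f (v k ω) * g (v a ω) ∂μ = 0 := fun k hk =>
      orth (mfS k hk) hg (g0 a)
    have l1f := (indep mL1 hf).memLp_two_mul L12 fa2
    have l2g := (indep mL2 hg).memLp_two_mul L22 ga2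
    -- D collects all terms involving the new index a. Each is a function of the old variables times
    -- a centered function of `v a`, so D is orthogonal to U and the second moments add. The
    -- off-diagonal terms need no centering, their means being zero.
    set D : Ω → ℝ := fun ω => ψ (v a ω) + L1 ω * f (v a ω) + L2 ω * g (v a ω) with hD
    have D2 : MemLp D 2 μ := (ψ2.add l1f).add l2g
    have expand : ∀ ω, ∑ j ∈ insert a S, ∑ k ∈ insert a S, M j k *
        (f (v j ω) * g (v k ω) - ∫ ω', f (v j ω') * g (v k ω') ∂μ) = U ω + D ω := by
      intro ω
      have e1 : ∑ k ∈ S, M a k * (f (v a ω) * g (v k ω) - ∫ ω', f (v a ω') * g (v k ω') ∂μ) =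
          L1 ω * f (v a ω) := by
        simp only [hL1, Finset.sum_mul]
        exact Finset.sum_congr rfl fun k hk => by rw [cross1 k hk]; ring
      have e2 : ∑ k ∈ S, M k a * (f (v k ω) * g (v a ω) - ∫ ω', f (v k ω') * g (v a ω') ∂μ) =
          L2 ω * g (v a ω) := by
        simp only [hL2, Finset.sum_mul]
        exact Finset.sum_congr rfl fun k hk => by rw [cross2 k hk]; ring
      simp only [Finset.sum_insert ha, Finset.sum_add_distrib, e1, e2, hD, hψ, hU]
      ring
    have UD : ∫ ω, U ω * D ω ∂μ = 0 := by
      have e : ∀ ω, U ω * D ω = U ω * ψ (v a ω) + (U ω * L1 ω) * f (v a ω) +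
          (U ω * L2 ω) * g (v a ω) := fun ω => by simp only [hD]; ring
      have i1 : Integrable (fun ω => U ω * ψ (v a ω)) μ := U2.integrable_mul ψ2
      have i2 : Integrable (fun ω => (U ω * L1 ω) * f (v a ω)) μ := by
        simpa only [mul_assoc] using! U2.integrable_mul l1f
      have i3 : Integrable (fun ω => (U ω * L2 ω) * g (v a ω)) μ := by
        simpa only [mul_assoc] using! U2.integrable_mul l2g
      have i12 : Integrable (fun ω => U ω * ψ (v a ω) + (U ω * L1 ω) * f (v a ω)) μ := i1.add i2
      simp_rw [e]
      rw [integral_add i12 i3, integral_add i1 i2, orth mU mψ ψ0,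
        orth (h := fun ω => U ω * L1 ω) (mU.mul mL1) hf (f0 a),
        orth (h := fun ω => U ω * L2 ω) (mU.mul mL2) hg (g0 a)]
      simp
    have ψsq : ∫ ω, ψ (v a ω) ^ 2 ∂μ ≤ κ ^ 2 * M a a ^ 2 := by
      simp only [hψ, mul_pow, integral_const_mul]
      have h1 := variance_eq_integral
        (memLp_two_mul_of_memLp_four (f4 a) (g4 a)).aestronglyMeasurable.aemeasurable
      have h2 := variance_le_expectation_sq
        (memLp_two_mul_of_memLp_four (f4 a) (g4 a)).aestronglyMeasurable
      have h3 := integral_mul_sq_le_of_pow_four (f4 a) (g4 a) (hf.comp (hv a)) (hg.comp (hv a))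
        (fm a) (gm a)
      simp only [Pi.pow_apply] at h2
      rw [← h1, mul_comm]
      exact mul_le_mul_of_nonneg_right (h2.trans h3) (sq_nonneg _)
    have f2 := integral_sq_le_of_pow_four (f4 a) hκ (fm a)
    have g2 := integral_sq_le_of_pow_four (g4 a) hκ (gm a)
    have L1sq := (integral_sum_mul_moments_le hv hind hg g4 g0 hκ gm S (fun k => M a k)).1
    have L2sq := (integral_sum_mul_moments_le hv hind hf f4 f0 hκ fm S (fun k => M k a)).1
    have l1sq : ∫ ω, (L1 ω * f (v a ω)) ^ 2 ∂μ ≤ κ ^ 2 * ∑ k ∈ S, M a k ^ 2 := by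
      rw [(indep mL1 hf).integral_mul_pow (amb mL1) (hf.comp (hv a))]
      calc _ ≤ (κ * ∑ k ∈ S, M a k ^ 2) * κ := by gcongr
        _ = _ := by ring
    have l2sq : ∫ ω, (L2 ω * g (v a ω)) ^ 2 ∂μ ≤ κ ^ 2 * ∑ k ∈ S, M k a ^ 2 := by
      rw [(indep mL2 hg).integral_mul_pow (amb mL2) (hg.comp (hv a))]
      calc _ ≤ (κ * ∑ k ∈ S, M k a ^ 2) * κ := by gcongr
        _ = _ := by ring
    have Dsq : ∫ ω, D ω ^ 2 ∂μ ≤ 3 * (κ ^ 2 * M a a ^ 2 + κ ^ 2 * ∑ k ∈ S, M a k ^ 2 +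
        κ ^ 2 * ∑ k ∈ S, M k a ^ 2) := by
      have j1 : Integrable (fun ω => ψ (v a ω) ^ 2 + (L1 ω * f (v a ω)) ^ 2) μ :=
        ψ2.integrable_sq.add l1f.integrable_sq
      have j2 : Integrable (fun ω => ψ (v a ω) ^ 2 + (L1 ω * f (v a ω)) ^ 2 +
        (L2 ω * g (v a ω)) ^ 2) μ := j1.add l2g.integrable_sq
      calc ∫ ω, D ω ^ 2 ∂μ ≤ ∫ ω, 3 * (ψ (v a ω) ^ 2 + (L1 ω * f (v a ω)) ^ 2 +
            (L2 ω * g (v a ω)) ^ 2) ∂μ := by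
            refine integral_mono D2.integrable_sq (j2.const_mul 3) fun ω => ?_
            simp only [hD]
            set p := ψ (v a ω)
            set q := L1 ω * f (v a ω)
            set r := L2 ω * g (v a ω)
            nlinarith [sq_nonneg (p - q), sq_nonneg (p - r), sq_nonneg (q - r)]
        _ = 3 * (∫ ω, ψ (v a ω) ^ 2 ∂μ + ∫ ω, (L1 ω * f (v a ω)) ^ 2 ∂μ +
            ∫ ω, (L2 ω * g (v a ω)) ^ 2 ∂μ) := by
            rw [integral_const_mul, integral_add j1 l2g.integrable_sq,
              integral_add ψ2.integrable_sq l1f.integrable_sq]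
        _ ≤ _ := by gcongr
    have iUD : Integrable (fun ω => 2 * (U ω * D ω)) μ := (U2.integrable_mul D2).const_mul 2
    have iUUDD : Integrable (fun ω => U ω ^ 2 + D ω ^ 2) μ := U2.integrable_sq.add D2.integrable_sq
    have e : ∀ ω, (U ω + D ω) ^ 2 = U ω ^ 2 + D ω ^ 2 + 2 * (U ω * D ω) := fun ω => by ring
    simp_rw [expand, e]
    rw [integral_add iUUDD iUD, integral_add U2.integrable_sq D2.integrable_sq, integral_const_mul,
      UD]
    simp only [Finset.sum_insert ha, Finset.sum_add_distrib]
    linarith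

end Moments

/-! ### Covariance forms and the random weights. -/

section LinearWeights

variable {Ω ι : Type*} {m : MeasurableSpace Ω} {d : ℕ}

/-- Independent centered random vectors whose coordinates have fourth moments at most `κ ^ 2`. -/
structure IsCenteredIndep (μ : Measure Ω) (v : ι → Ω → Fin d → ℝ) (κ : ℝ) : Prop where
  measurable : ∀ k, Measurable (v k)
  indep : iIndepFun v μ
  nonneg : 0 ≤ κ
  memLp_four : ∀ k l, MemLp (fun ω => v k ω l) 4 μ
  integral_eq_zero : ∀ k l, ∫ ω, v k ω l ∂μ = 0
  integral_pow_four_le : ∀ k l, ∫ ω, v k ω l ^ 4 ∂μ ≤ κ ^ 2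

/-- The second moments of the coordinates of `v k`. -/
noncomputable def coordCov (μ : Measure Ω) (v : ι → Ω → Fin d → ℝ) (k : ι) (l l' : Fin d) : ℝ :=
  ∫ ω, v k ω l * v k ω l' ∂μ

/-- The quadratic form of the covariance matrix of `v k`. -/
noncomputable def covForm (μ : Measure Ω) (v : ι → Ω → Fin d → ℝ) (k : ι) (x : Fin d → ℝ) : ℝ :=
  ∑ l, ∑ l', coordCov μ v k l l' * (x l * x l')

lemma pow_four_sum_le {α : Type*} (S : Finset α) (f : α → ℝ) :
    (∑ i ∈ S, f i) ^ 4 ≤ (S.card : ℝ) ^ 3 * ∑ i ∈ S, f i ^ 4 := by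
  have h1 := sq_sum_le_card_mul_sum_sq (s := S) (f := f)
  have h2 := sq_sum_le_card_mul_sum_sq (s := S) (f := fun i => f i ^ 2)
  calc (∑ i ∈ S, f i) ^ 4 = ((∑ i ∈ S, f i) ^ 2) ^ 2 := by ring
    _ ≤ (S.card * ∑ i ∈ S, f i ^ 2) ^ 2 := by gcongr
    _ = (S.card : ℝ) ^ 2 * (∑ i ∈ S, f i ^ 2) ^ 2 := by ring
    _ ≤ (S.card : ℝ) ^ 2 * (S.card * ∑ i ∈ S, (f i ^ 2) ^ 2) := by gcongr
    _ = _ := by simp_rw [← pow_mul]; ring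

namespace IsCenteredIndep

variable {μ : Measure Ω} {v : ι → Ω → Fin d → ℝ} {κ : ℝ}

lemma measurable_coord (h : IsCenteredIndep μ v κ) (k : ι) (l : Fin d) :
    Measurable (fun ω => v k ω l) :=
  (measurable_pi_apply l).comp (h.measurable k)

lemma coordCov_comm (k : ι) (l l' : Fin d) : coordCov μ v k l l' = coordCov μ v k l' l := by
  simp only [coordCov, mul_comm]

lemma covForm_add (k : ι) (x y : Fin d → ℝ) : covForm μ v k (fun l => x l + y l) =
    covForm μ v k x + 2 * ∑ l, (∑ l', coordCov μ v k l l' * x l') * y l + covForm μ v k y := by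
  have e : ∑ l, (∑ l', coordCov μ v k l l' * x l') * y l =
      ∑ l, ∑ l', coordCov μ v k l l' * (x l * y l') := by
    simp_rw [Finset.sum_mul]
    rw [Finset.sum_comm]
    exact Finset.sum_congr rfl fun l _ => Finset.sum_congr rfl fun l' _ => by
      rw [coordCov_comm]; ring
  have e' : ∑ l, (∑ l', coordCov μ v k l l' * x l') * y l =
      ∑ l, ∑ l', coordCov μ v k l l' * (y l * x l') := by
    simp_rw [Finset.sum_mul]
    exact Finset.sum_congr rfl fun l _ => Finset.sum_congr rfl fun l' _ => by ring
  rw [two_mul]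
  nth_rewrite 1 [e]
  rw [e']
  simp only [covForm, ← Finset.sum_add_distrib]
  exact Finset.sum_congr rfl fun l _ => Finset.sum_congr rfl fun l' _ => by ring

variable [IsProbabilityMeasure μ]

lemma integral_sq_le (h : IsCenteredIndep μ v κ) (k : ι) (l : Fin d) :
    ∫ ω, v k ω l ^ 2 ∂μ ≤ κ :=
  integral_sq_le_of_pow_four (h.memLp_four k l) h.nonneg (h.integral_pow_four_le k l)

lemma memLp_two (h : IsCenteredIndep μ v κ) (k : ι) (l : Fin d) :
    MemLp (fun ω => v k ω l) 2 μ :=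
  (h.memLp_four k l).mono_exponent (by norm_num)

lemma integrable_mul_coord (h : IsCenteredIndep μ v κ) (k k' : ι) (l l' : Fin d) :
    Integrable (fun ω => v k ω l * v k' ω l') μ :=
  (h.memLp_two k l).integrable_mul (h.memLp_two k' l')

lemma abs_coordCov_le (h : IsCenteredIndep μ v κ) (k : ι) (l l' : Fin d) :
    |coordCov μ v k l l'| ≤ κ := by
  have i1 := (h.memLp_two k l).integrable_sq
  have i2 := (h.memLp_two k l').integrable_sq
  have : |coordCov μ v k l l'| ≤ ∫ ω, (v k ω l ^ 2 + v k ω l' ^ 2) / 2 ∂μ := by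
    rw [coordCov, ← Real.norm_eq_abs]
    refine norm_integral_le_of_norm_le ((i1.add i2).div_const 2) (ae_of_all _ fun ω => ?_)
    rw [Real.norm_eq_abs, abs_le]
    constructor <;> nlinarith [sq_nonneg (v k ω l - v k ω l'), sq_nonneg (v k ω l + v k ω l')]
  rw [integral_div, integral_add i1 i2] at this
  linarith [h.integral_sq_le k l, h.integral_sq_le k l']

lemma covForm_eq (h : IsCenteredIndep μ v κ) (k : ι) (x : Fin d → ℝ) :
    covForm μ v k x = ∫ ω, (∑ l, x l * v k ω l) ^ 2 ∂μ := by
  have e : ∀ ω, (∑ l, x l * v k ω l) ^ 2 = ∑ l, ∑ l', (x l * x l') * (v k ω l * v k ω l') :=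
    fun ω => by
      rw [sq, Finset.sum_mul_sum]
      exact Finset.sum_congr rfl fun l _ => Finset.sum_congr rfl fun l' _ => by ring
  simp_rw [e]
  rw [integral_finsetSum _ fun l _ => integrable_finsetSum _ fun l' _ =>
    (h.integrable_mul_coord k k l l').const_mul _]
  refine Finset.sum_congr rfl fun l _ => ?_
  rw [integral_finsetSum _ fun l' _ => (h.integrable_mul_coord k k l l').const_mul _]
  refine Finset.sum_congr rfl fun l' _ => ?_
  rw [integral_const_mul, coordCov, mul_comm]

lemma covForm_nonneg (h : IsCenteredIndep μ v κ) (k : ι) (x : Fin d → ℝ) : 0 ≤ covForm μ v k x := by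
  rw [h.covForm_eq]
  positivity

/-- Cauchy–Schwarz for the covariance form between x and the l-th unit vector: the form at x + y e_l
is a nonnegative quadratic in y, so its discriminant is nonpositive. This lets the variance control
Σ_k s_k when s_k itself is not controlled. -/
lemma sq_sum_coordCov_mul_le (h : IsCenteredIndep μ v κ) (k : ι) (x : Fin d → ℝ) (l : Fin d) :
    (∑ l', coordCov μ v k l l' * x l') ^ 2 ≤ κ * covForm μ v k x := by
  set c := covForm μ v k x with hc
  set r := ∑ l', coordCov μ v k l l' * x l' with hr
  have h0 : ∀ y : ℝ, 0 ≤ c + 2 * (r * y) + coordCov μ v k l l * y ^ 2 := by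
    intro y
    have h1 := h.covForm_nonneg k (fun l' => x l' + if l' = l then y else 0)
    rw [covForm_add] at h1
    have h2 : covForm μ v k (fun l' => if l' = l then y else 0) = coordCov μ v k l l * y ^ 2 := by
      simp [covForm, sq]
    rw [h2] at h1
    simpa using h1
  have hcc : coordCov μ v k l l ≤ κ := (le_abs_self _).trans (h.abs_coordCov_le k l l)
  have hc0 : 0 ≤ c := h.covForm_nonneg k x
  have hdisc := discrim_le_zero (a := coordCov μ v k l l) (b := 2 * r) (c := c)
    (fun y => by have := h0 y; nlinarith)
  rw [discrim] at hdisc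
  nlinarith

end IsCenteredIndep

variable [Fintype ι]

/-- The linear combination of the `p.2`-th coordinates with the `k`-th row of `b p`. -/
def rowSum (b : Fin d × Fin d → Matrix ι ι ℝ) (v : ι → Ω → Fin d → ℝ) (p : Fin d × Fin d)
    (k : ι) (ω : Ω) : ℝ :=
  ∑ j, b p k j * v j ω p.2

/-- The vector by which `v k` is multiplied in the `k`-th martingale difference. -/
def weight (s : ι → Fin d → ℝ) (b : Fin d × Fin d → Matrix ι ι ℝ) (v : ι → Ω → Fin d → ℝ)
    (k : ι) (ω : Ω) (l : Fin d) : ℝ :=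
  s k l + ∑ l', rowSum b v (l, l') k ω

/-- The product of `v k` with its weight. -/
def weightedDiff (s : ι → Fin d → ℝ) (b : Fin d × Fin d → Matrix ι ι ℝ) (v : ι → Ω → Fin d → ℝ)
    (k : ι) (ω : Ω) : ℝ :=
  ∑ l, weight s b v k ω l * v k ω l

namespace IsCenteredIndep

variable {μ : Measure Ω} {v : ι → Ω → Fin d → ℝ} {κ : ℝ}

lemma memLp_rowSum (h : IsCenteredIndep μ v κ) (b : Fin d × Fin d → Matrix ι ι ℝ)
    (p : Fin d × Fin d) (k : ι) : MemLp (rowSum b v p k) 4 μ :=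
  memLp_sum_mul (fun j => h.memLp_four j p.2) _ _

lemma measurable_rowSum (h : IsCenteredIndep μ v κ) (b : Fin d × Fin d → Matrix ι ι ℝ)
    (p : Fin d × Fin d) (k : ι) : Measurable (rowSum b v p k) :=
  Finset.measurable_fun_sum _ fun j _ => (h.measurable_coord j p.2).const_mul _

variable [IsProbabilityMeasure μ]

lemma memLp_weight (h : IsCenteredIndep μ v κ) (s : ι → Fin d → ℝ)
    (b : Fin d × Fin d → Matrix ι ι ℝ) (k : ι) (l : Fin d) :
    MemLp (fun ω => weight s b v k ω l) 4 μ := by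
  have h1 : MemLp (fun ω => ∑ l', rowSum b v (l, l') k ω) 4 μ :=
    memLp_finsetSum _ fun l' _ => h.memLp_rowSum b (l, l') k
  exact (memLp_const (s k l)).add h1

lemma coord_moments_le (h : IsCenteredIndep μ v κ) (l : Fin d) (c : ι → ℝ) :
    ∫ ω, (∑ j, c j * v j ω l) ^ 2 ∂μ ≤ κ * ∑ j, c j ^ 2 ∧
    ∫ ω, (∑ j, c j * v j ω l) ^ 4 ∂μ ≤ 3 * (κ * ∑ j, c j ^ 2) ^ 2 :=
  integral_sum_mul_moments_le h.measurable h.indep (f := fun x => x l) (measurable_pi_apply l)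
    (fun j => h.memLp_four j l) (fun j => h.integral_eq_zero j l) h.nonneg
    (fun j => h.integral_pow_four_le j l) Finset.univ c

/-- The factors 8 = 2³ and d³ come from the power-mean inequality for two and for d summands, and
3κ² from the fourth moment of a linear form. -/
lemma integral_pow_four_weight_le (h : IsCenteredIndep μ v κ) (s : ι → Fin d → ℝ)
    (b : Fin d × Fin d → Matrix ι ι ℝ) (k : ι) (l : Fin d) :
    ∫ ω, weight s b v k ω l ^ 4 ∂μ ≤
      8 * (s k l ^ 4 + d ^ 3 * ∑ l', 3 * κ ^ 2 * (∑ j, b (l, l') k j ^ 2) ^ 2) := by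
  have hi : ∀ l', Integrable (fun ω => rowSum b v (l, l') k ω ^ 4) μ := fun l' =>
    (memLp_four_iff_integrable_pow (h.measurable_rowSum b _ k)).1 (h.memLp_rowSum b _ k)
  have hw : Measurable (fun ω => weight s b v k ω l) :=
    (Finset.measurable_fun_sum _ fun l' _ => h.measurable_rowSum b _ k).const_add _
  have hI : Integrable (fun ω => 8 * (s k l ^ 4 + d ^ 3 * ∑ l', rowSum b v (l, l') k ω ^ 4)) μ :=
    ((integrable_const _).add ((integrable_finsetSum _ fun l' _ => hi l').const_mul _)).const_mul _
  calc ∫ ω, weight s b v k ω l ^ 4 ∂μ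
      ≤ ∫ ω, 8 * (s k l ^ 4 + d ^ 3 * ∑ l', rowSum b v (l, l') k ω ^ 4) ∂μ := by
        refine integral_mono ((memLp_four_iff_integrable_pow hw).1 (h.memLp_weight s b k l)) hI
          fun ω => ?_
        have h1 := pow_four_sum_le Finset.univ (fun l' => rowSum b v (l, l') k ω)
        simp only [Finset.card_univ, Fintype.card_fin] at h1
        simp only [weight]
        set x := s k l
        set y := ∑ l', rowSum b v (l, l') k ω
        have h2 : (x + y) ^ 4 ≤ 8 * (x ^ 4 + y ^ 4) := by
          have a1 : (x + y) ^ 2 ≤ 2 * (x ^ 2 + y ^ 2) := by nlinarith [sq_nonneg (x - y)]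
          calc (x + y) ^ 4 = ((x + y) ^ 2) ^ 2 := by ring
            _ ≤ (2 * (x ^ 2 + y ^ 2)) ^ 2 := by gcongr
            _ ≤ _ := by nlinarith [sq_nonneg (x ^ 2 - y ^ 2)]
        linarith
    _ = 8 * (s k l ^ 4 + d ^ 3 * ∑ l', ∫ ω, rowSum b v (l, l') k ω ^ 4 ∂μ) := by
        rw [integral_const_mul, integral_add (integrable_const _)
          ((integrable_finsetSum _ fun l' _ => hi l').const_mul _), integral_const_mul,
          integral_finsetSum _ fun l' _ => hi l']
        simp
    _ ≤ _ := by
        gcongr with l' _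
        refine (h.coord_moments_le l' (fun j => b (l, l') k j)).2.trans_eq ?_
        ring

end IsCenteredIndep

end LinearWeights

/-! ### Concentration of the sum of conditional variances. -/

section ConditionalVariance

variable {Ω ι : Type*} {m : MeasurableSpace Ω} {d : ℕ} [Fintype ι]

namespace IsCenteredIndep

variable {μ : Measure Ω} {v : ι → Ω → Fin d → ℝ} {κ : ℝ}

lemma sum_coordCov_mul_rowSum_eq (r : ι → Fin d → ℝ) (b : Fin d × Fin d → Matrix ι ι ℝ) (ω : Ω) :
    ∑ k, ∑ l, r k l * ∑ l', rowSum b v (l, l') k ω =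
      ∑ p, ∑ j, (∑ k, r k p.1 * b p k j) * v j ω p.2 := by
  have h1 : ∀ k, ∑ l, r k l * ∑ l', rowSum b v (l, l') k ω =
      ∑ p : Fin d × Fin d, r k p.1 * rowSum b v p k ω := fun k => by
    rw [Fintype.sum_prod_type]
    simp_rw [Finset.mul_sum]
  simp_rw [h1]
  rw [Finset.sum_comm]
  refine Finset.sum_congr rfl fun p _ => ?_
  simp_rw [rowSum, Finset.mul_sum, Finset.sum_mul]
  rw [Finset.sum_comm]
  exact Finset.sum_congr rfl fun j _ => Finset.sum_congr rfl fun k _ => by ring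

lemma sum_covForm_rowSum_eq (b : Fin d × Fin d → Matrix ι ι ℝ) (ω : Ω) :
    ∑ k, covForm μ v k (fun l => ∑ l', rowSum b v (l, l') k ω) =
      ∑ p, ∑ p', ∑ j, ∑ j', (∑ k, coordCov μ v k p.1 p'.1 * b p k j * b p' k j') *
        (v j ω p.2 * v j' ω p'.2) := by
  have h1 : ∀ k, covForm μ v k (fun l => ∑ l', rowSum b v (l, l') k ω) =
      ∑ p : Fin d × Fin d, ∑ p' : Fin d × Fin d,
        coordCov μ v k p.1 p'.1 * (rowSum b v p k ω * rowSum b v p' k ω) := fun k => by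
    simp_rw [Fintype.sum_prod_type, covForm, Finset.sum_mul_sum, Finset.mul_sum]
    exact Finset.sum_congr rfl fun l _ => Finset.sum_comm
  simp_rw [h1]
  rw [Finset.sum_comm]
  refine Finset.sum_congr rfl fun p _ => ?_
  rw [Finset.sum_comm]
  refine Finset.sum_congr rfl fun p' _ => ?_
  simp_rw [rowSum, Finset.sum_mul_sum, Finset.mul_sum, Finset.sum_mul]
  rw [Finset.sum_comm]
  refine Finset.sum_congr rfl fun j _ => ?_
  rw [Finset.sum_comm]
  exact Finset.sum_congr rfl fun j' _ => Finset.sum_congr rfl fun k _ => by ring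

variable [IsProbabilityMeasure μ]

/-- The conditional variances of the weighted differences have a sum with small variance. -/
lemma integral_sum_covForm_weight (h : IsCenteredIndep μ v κ) (s : ι → Fin d → ℝ)
    (b : Fin d × Fin d → Matrix ι ι ℝ) {γ : ℝ} (hγ : ∀ p, gramNormSq (b p) ≤ γ) :
    MemLp (fun ω => ∑ k, covForm μ v k (weight s b v k ω)) 2 μ ∧
    ∫ ω, (∑ k, covForm μ v k (weight s b v k ω) -
        ∫ ω', ∑ k, covForm μ v k (weight s b v k ω') ∂μ) ^ 2 ∂μ ≤
      8 * d ^ 4 * κ ^ 2 * √γ * (∫ ω', ∑ k, covForm μ v k (weight s b v k ω') ∂μ) +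
        6 * d ^ 8 * κ ^ 4 * γ := by
  have hκ := h.nonneg
  set V : Ω → ℝ := fun ω => ∑ k, covForm μ v k (weight s b v k ω) with hV
  set r : ι → Fin d → ℝ := fun k l => ∑ l', coordCov μ v k l l' * s k l' with hr
  set c1 := ∑ k, covForm μ v k (s k) with hc1
  set Lin : Fin d × Fin d → Ω → ℝ := fun p ω => ∑ j, (∑ k, r k p.1 * b p k j) * v j ω p.2 with hLin
  set M : Fin d × Fin d → Fin d × Fin d → ι → ι → ℝ := fun p p' j j' =>
    ∑ k, coordCov μ v k p.1 p'.1 * b p k j * b p' k j' with hM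
  set Q : Fin d × Fin d → Fin d × Fin d → Ω → ℝ := fun p p' ω => ∑ j, ∑ j', M p p' j j' *
    (v j ω p.2 * v j' ω p'.2 - ∫ ω', v j ω' p.2 * v j' ω' p'.2 ∂μ) with hQ
  set c2 := ∑ p, ∑ p', ∑ j, ∑ j', M p p' j j' * ∫ ω', v j ω' p.2 * v j' ω' p'.2 ∂μ with hc2
  have e1 : ∀ ω, V ω = c1 + 2 * ∑ p, Lin p ω +
      ∑ k, covForm μ v k (fun l => ∑ l', rowSum b v (l, l') k ω) := by
    intro ω
    have e : ∀ k, covForm μ v k (weight s b v k ω) = covForm μ v k (s k) +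
        2 * ∑ l, r k l * ∑ l', rowSum b v (l, l') k ω +
        covForm μ v k (fun l => ∑ l', rowSum b v (l, l') k ω) := fun k => covForm_add k _ _
    simp only [hV, e, Finset.sum_add_distrib, ← Finset.mul_sum, sum_coordCov_mul_rowSum_eq, hLin,
      hc1]
  -- A constant, a linear form and a centered quadratic form; hence c1 + c2 is the mean of V.
  have e2 : ∀ ω, V ω = c1 + c2 + (2 * ∑ p, Lin p ω + ∑ p, ∑ p', Q p p' ω) := by
    intro ω
    rw [e1, sum_covForm_rowSum_eq]
    simp only [hQ, hc2, mul_sub, Finset.sum_sub_distrib, hM]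
    ring
  have Lin4 : ∀ p, MemLp (Lin p) 4 μ := fun p => memLp_sum_mul (fun j => h.memLp_four j p.2) _ _
  have Lin2 : ∀ p, MemLp (Lin p) 2 μ := fun p => (Lin4 p).mono_exponent (by norm_num)
  have Lin0 : ∀ p, ∫ ω, Lin p ω ∂μ = 0 := fun p => by
    simp only [hLin]
    rw [integral_finsetSum _ fun j _ => ((h.memLp_four j p.2).integrable (by norm_num)).const_mul _]
    simp [integral_const_mul, h.integral_eq_zero]
  have Q2 : ∀ p p', MemLp (Q p p') 2 μ := fun p p' => memLp_finsetSum _ fun j _ =>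
    memLp_finsetSum _ fun j' _ => ((memLp_two_mul_of_memLp_four (h.memLp_four j p.2)
      (h.memLp_four j' p'.2)).sub (memLp_const _)).const_mul _
  have Q0 : ∀ p p', ∫ ω, Q p p' ω ∂μ = 0 := fun p p' => by
    simp only [hQ]
    have i : ∀ j j', Integrable (fun ω => M p p' j j' * (v j ω p.2 * v j' ω p'.2 -
        ∫ ω', v j ω' p.2 * v j' ω' p'.2 ∂μ)) μ := fun j j' =>
      ((h.integrable_mul_coord j j' _ _).sub (integrable_const _)).const_mul _
    rw [integral_finsetSum _ fun j _ => integrable_finsetSum _ fun j' _ => i j j']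
    refine Finset.sum_eq_zero fun j _ => ?_
    rw [integral_finsetSum _ fun j' _ => i j j']
    refine Finset.sum_eq_zero fun j' _ => ?_
    rw [integral_const_mul, integral_sub (h.integrable_mul_coord j j' _ _) (integrable_const _)]
    simp
  have SL2 : MemLp (fun ω => ∑ p, Lin p ω) 2 μ := memLp_finsetSum _ fun p _ => Lin2 p
  have SQ2 : MemLp (fun ω => ∑ p, ∑ p', Q p p' ω) 2 μ :=
    memLp_finsetSum _ fun p _ => memLp_finsetSum _ fun p' _ => Q2 p p'
  have SL0 : ∫ ω, ∑ p, Lin p ω ∂μ = 0 := by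
    rw [integral_finsetSum _ fun p _ => (Lin2 p).integrable (by norm_num)]
    simp [Lin0]
  have SQ0 : ∫ ω, ∑ p, ∑ p', Q p p' ω ∂μ = 0 := by
    rw [integral_finsetSum _ fun p _ => integrable_finsetSum _ fun p' _ =>
      (Q2 p p').integrable (by norm_num)]
    refine Finset.sum_eq_zero fun p _ => ?_
    rw [integral_finsetSum _ fun p' _ => (Q2 p p').integrable (by norm_num)]
    simp [Q0]
  have iL := SL2.integrable (by norm_num)
  have iQ := SQ2.integrable (by norm_num)
  have V2 : MemLp V 2 μ := by
    have : V = fun ω => c1 + c2 + (2 * ∑ p, Lin p ω + ∑ p, ∑ p', Q p p' ω) := funext e2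
    rw [this]
    exact (memLp_const (c1 + c2)).add ((SL2.const_mul 2).add SQ2)
  have EV : ∫ ω, V ω ∂μ = c1 + c2 := by
    simp_rw [e2]
    have iLQ : Integrable (fun ω => 2 * ∑ p, Lin p ω + ∑ p, ∑ p', Q p p' ω) μ :=
      (iL.const_mul 2).add iQ
    rw [integral_add (integrable_const _) iLQ, integral_add (iL.const_mul 2) iQ, integral_const_mul, SL0, SQ0]
    simp
  -- Drop the nonnegative quadratic part of V; the linear part has mean zero.
  have c1_le : c1 ≤ ∫ ω, V ω ∂μ := by
    have : ∫ ω, (c1 + 2 * ∑ p, Lin p ω) ∂μ ≤ ∫ ω, V ω ∂μ := by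
      refine integral_mono ((integrable_const _).add (iL.const_mul 2))
        (V2.integrable (by norm_num)) fun ω => ?_
      simp only
      rw [e1]
      have := Finset.sum_nonneg fun k (_ : k ∈ Finset.univ) =>
        h.covForm_nonneg k (fun l => ∑ l', rowSum b v (l, l') k ω)
      linarith
    rw [integral_add (integrable_const _) (iL.const_mul 2), integral_const_mul, SL0] at this
    simpa using this
  have r_le : ∀ l, ∑ k, r k l ^ 2 ≤ κ * ∫ ω, V ω ∂μ := fun l => by
    calc ∑ k, r k l ^ 2 ≤ ∑ k, κ * covForm μ v k (s k) :=
          Finset.sum_le_sum fun k _ => h.sq_sum_coordCov_mul_le k (s k) l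
      _ = κ * c1 := by rw [← Finset.mul_sum]
      _ ≤ _ := by gcongr
  set EVv := ∫ ω, V ω ∂μ with hEVv
  have EV0 : 0 ≤ EVv := integral_nonneg fun ω =>
    Finset.sum_nonneg fun k _ => h.covForm_nonneg k _
  have Lsq : ∀ p, ∫ ω, Lin p ω ^ 2 ∂μ ≤ κ ^ 2 * √γ * EVv := fun p => by
    calc ∫ ω, Lin p ω ^ 2 ∂μ ≤ κ * ∑ j, (∑ k, r k p.1 * b p k j) ^ 2 :=
          (h.coord_moments_le p.2 _).1
      _ ≤ κ * (√γ * (κ * EVv)) := by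
          gcongr
          refine (sum_sq_sum_weighted_le (fun k => r k p.1) (b p)).trans ?_
          gcongr
          · exact hγ p
          · exact r_le p.1
      _ = _ := by ring
  have Qsq : ∀ p p', ∫ ω, Q p p' ω ^ 2 ∂μ ≤ 3 * κ ^ 4 * γ := fun p p' => by
    calc ∫ ω, Q p p' ω ^ 2 ∂μ ≤ 3 * κ ^ 2 * ∑ j, ∑ j', M p p' j j' ^ 2 :=
          integral_sq_centered_quadratic_le h.measurable h.indep (f := fun x => x p.2)
            (g := fun x => x p'.2) (measurable_pi_apply _) (measurable_pi_apply _)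
            (fun j => h.memLp_four j _) (fun j => h.memLp_four j _)
            (fun j => h.integral_eq_zero j _) (fun j => h.integral_eq_zero j _) h.nonneg
            (fun j => h.integral_pow_four_le j _) (fun j => h.integral_pow_four_le j _) _ _
      _ ≤ 3 * κ ^ 2 * (κ ^ 2 * (gramNormSq (b p) + gramNormSq (b p')) / 2) := by
          gcongr
          exact sum_sq_sum_weighted_mul_le _ (fun k => h.abs_coordCov_le k _ _) _ _
      _ ≤ 3 * κ ^ 2 * (κ ^ 2 * (γ + γ) / 2) := by
          gcongr
          · exact hγ p
          · exact hγ p'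
      _ = _ := by ring
  -- One factor d² is the Cauchy–Schwarz cost over the d² pairs p, the other their number. For Q the
  -- pairs (p, p') give d⁴ twice.
  have SLsq : ∫ ω, (∑ p, Lin p ω) ^ 2 ∂μ ≤ d ^ 4 * (κ ^ 2 * √γ * EVv) := by
    calc ∫ ω, (∑ p, Lin p ω) ^ 2 ∂μ ≤ ∫ ω, (d ^ 2 : ℝ) * ∑ p, Lin p ω ^ 2 ∂μ := by
          refine integral_mono SL2.integrable_sq
            ((integrable_finsetSum _ fun p _ => (Lin2 p).integrable_sq).const_mul _) fun ω => ?_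
          have := sq_sum_le_card_mul_sum_sq (s := (Finset.univ : Finset (Fin d × Fin d)))
            (f := fun p => Lin p ω)
          simpa [sq] using this
      _ = d ^ 2 * ∑ p, ∫ ω, Lin p ω ^ 2 ∂μ := by
          rw [integral_const_mul, integral_finsetSum _ fun p _ => (Lin2 p).integrable_sq]
      _ ≤ d ^ 2 * ∑ p : Fin d × Fin d, κ ^ 2 * √γ * EVv := by gcongr with p _; exact Lsq p
      _ = _ := by simp; ring
  have SQsq : ∫ ω, (∑ p, ∑ p', Q p p' ω) ^ 2 ∂μ ≤ d ^ 8 * (3 * κ ^ 4 * γ) := by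
    calc ∫ ω, (∑ p, ∑ p', Q p p' ω) ^ 2 ∂μ
        ≤ ∫ ω, (d ^ 4 : ℝ) * ∑ p, ∑ p', Q p p' ω ^ 2 ∂μ := by
          refine integral_mono SQ2.integrable_sq
            ((integrable_finsetSum _ fun p _ => integrable_finsetSum _ fun p' _ =>
              (Q2 p p').integrable_sq).const_mul _) fun ω => ?_
          have := sq_sum_le_card_mul_sum_sq
            (s := (Finset.univ : Finset ((Fin d × Fin d) × (Fin d × Fin d))))
            (f := fun p => Q p.1 p.2 ω)
          simp only [Fintype.sum_prod_type (γ := ℝ) (α₁ := Fin d × Fin d), Finset.card_univ,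
            Fintype.card_prod, Fintype.card_fin] at this
          refine this.trans_eq ?_
          push_cast
          ring
      _ = d ^ 4 * ∑ p, ∑ p', ∫ ω, Q p p' ω ^ 2 ∂μ := by
          rw [integral_const_mul, integral_finsetSum _ fun p _ => integrable_finsetSum _
            fun p' _ => (Q2 p p').integrable_sq]
          congr 1
          exact Finset.sum_congr rfl fun p _ =>
            integral_finsetSum _ fun p' _ => (Q2 p p').integrable_sq
      _ ≤ d ^ 4 * ∑ p : Fin d × Fin d, ∑ p' : Fin d × Fin d, 3 * κ ^ 4 * γ := by
          gcongr with p _ p' _; exact Qsq p p'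
      _ = _ := by simp; ring
  refine ⟨V2, ?_⟩
  have hdev : ∀ ω, (V ω - EVv) ^ 2 = (2 * ∑ p, Lin p ω + ∑ p, ∑ p', Q p p' ω) ^ 2 := fun ω => by
    rw [EV, e2]; ring
  calc ∫ ω, (V ω - EVv) ^ 2 ∂μ
      ≤ ∫ ω, (8 * (∑ p, Lin p ω) ^ 2 + 2 * (∑ p, ∑ p', Q p p' ω) ^ 2) ∂μ := by
        refine integral_mono (V2.sub (memLp_const EVv)).integrable_sq
          ((SL2.integrable_sq.const_mul 8).add (SQ2.integrable_sq.const_mul 2)) fun ω => ?_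
        simp only
        rw [hdev]
        nlinarith [sq_nonneg (2 * ∑ p, Lin p ω - ∑ p, ∑ p', Q p p' ω)]
    _ = 8 * ∫ ω, (∑ p, Lin p ω) ^ 2 ∂μ + 2 * ∫ ω, (∑ p, ∑ p', Q p p' ω) ^ 2 ∂μ := by
        rw [integral_add (SL2.integrable_sq.const_mul 8) (SQ2.integrable_sq.const_mul 2),
          integral_const_mul, integral_const_mul]
    _ ≤ 8 * (d ^ 4 * (κ ^ 2 * √γ * EVv)) + 2 * (d ^ 8 * (3 * κ ^ 4 * γ)) := by gcongr
    _ ≤ _ := by linarith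

end IsCenteredIndep

end ConditionalVariance

/-! ### The martingale structure of the weighted differences. -/

section WeightedDifferences

variable {Ω : Type*} {m : MeasurableSpace Ω} {d n : ℕ}

/-- The σ-algebra generated by the first `N` random vectors. -/
@[reducible] def pastSigma (v : Fin n → Ω → Fin d → ℝ) (N : ℕ) : MeasurableSpace Ω :=
  generatedBy v {j | (j : ℕ) < N}

/-- The extension by zero of a family indexed by `Fin n` to a sequence. -/
def extendZero (f : Fin n → Ω → ℝ) (N : ℕ) (ω : Ω) : ℝ :=
  if h : N < n then f ⟨N, h⟩ ω else 0

lemma extendZero_of_lt (f : Fin n → Ω → ℝ) {N : ℕ} (h : N < n) : extendZero f N = f ⟨N, h⟩ := by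
  ext ω; simp [extendZero, h]

lemma extendZero_of_not_lt (f : Fin n → Ω → ℝ) {N : ℕ} (h : ¬ N < n) :
    extendZero f N = fun _ => 0 := by
  ext ω; simp [extendZero, h]

lemma extendZero_coe (f : Fin n → Ω → ℝ) (k : Fin n) : extendZero f k = f k :=
  extendZero_of_lt f k.2

lemma sum_range_extendZero (f : Fin n → Ω → ℝ) (ω : Ω) :
    ∑ k ∈ Finset.range n, extendZero f k ω = ∑ k, f k ω := by
  simp only [Finset.sum_range, extendZero_coe]

namespace IsCenteredIndep

variable {μ : Measure Ω} {v : Fin n → Ω → Fin d → ℝ} {κ : ℝ} {s : Fin n → Fin d → ℝ}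
  {b : Fin d × Fin d → Matrix (Fin n) (Fin n) ℝ}

/-- Strict triangularity of b leaves only the vectors with index below k in the weight. -/
lemma measurable_weight_past (hb : ∀ p k j, k ≤ j → b p k j = 0) (k : Fin n) (l : Fin d) :
    Measurable[pastSigma v k] (fun ω => weight s b v k ω l) := by
  refine Measurable.const_add (Finset.measurable_fun_sum _ fun l' _ =>
    Finset.measurable_fun_sum _ fun j _ => ?_) _
  rcases lt_or_ge j k with hj | hj
  · exact ((measurable_pi_apply l').comp (measurable_generatedBy v
      (S := {j | (j : ℕ) < k}) hj)).const_mul _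
  · simp only [hb _ k j hj, zero_mul]
    exact measurable_const

lemma indepFun_past (h : IsCenteredIndep μ v κ) {α β : Type*} [MeasurableSpace α]
    [MeasurableSpace β] (k : Fin n) {Y : Ω → α} (hY : Measurable[pastSigma v k] Y)
    {φ : (Fin d → ℝ) → β} (hφ : Measurable φ) : IndepFun Y (fun ω => φ (v k ω)) μ :=
  indepFun_of_measurable_generatedBy h.measurable h.indep (S := {j | (j : ℕ) < k}) (by simp) hY hφ

lemma past_le (h : IsCenteredIndep μ v κ) (N : ℕ) : pastSigma v N ≤ m :=
  generatedBy_le h.measurable _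

lemma measurable_weight (h : IsCenteredIndep μ v κ) (hb : ∀ p k j, k ≤ j → b p k j = 0) (k : Fin n)
    (l : Fin d) : Measurable (fun ω => weight s b v k ω l) :=
  (measurable_weight_past hb k l).mono (h.past_le _) le_rfl

lemma measurable_weightedDiff_past (hb : ∀ p k j, k ≤ j → b p k j = 0) (k : Fin n) :
    Measurable[pastSigma v (k + 1)] (weightedDiff s b v k) := by
  refine Finset.measurable_fun_sum _ fun l _ => Measurable.mul ?_ ?_
  · exact (measurable_weight_past hb k l).mono
      (generatedBy_mono v fun j (hj : (j : ℕ) < k) => Nat.lt_succ_of_lt hj) le_rfl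
  · exact (measurable_pi_apply l).comp (measurable_generatedBy v
      (S := {j | (j : ℕ) < (k : ℕ) + 1}) (Nat.lt_succ_self _))

lemma measurable_covForm_past (hb : ∀ p k j, k ≤ j → b p k j = 0) (k : Fin n) :
    Measurable[pastSigma v k] (fun ω => covForm μ v k (weight s b v k ω)) :=
  Finset.measurable_fun_sum _ fun l _ => Finset.measurable_fun_sum _ fun l' _ =>
    ((measurable_weight_past hb k l).mul (measurable_weight_past hb k l')).const_mul _

variable [IsProbabilityMeasure μ]

/-- The weight depends on the past only, so it is independent of `v k` and the fourth moments
multiply. -/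
lemma memLp_four_weight_mul (h : IsCenteredIndep μ v κ) (hb : ∀ p k j, k ≤ j → b p k j = 0)
    (k : Fin n) (l : Fin d) : MemLp (fun ω => weight s b v k ω l * v k ω l) 4 μ := by
  have hw := h.measurable_weight (s := s) hb k l
  have hv := h.measurable_coord k l
  have hwv : Measurable (fun ω => weight s b v k ω l * v k ω l) := hw.mul hv
  rw [memLp_four_iff_integrable_pow hwv]
  have ind := h.indepFun_past k ((measurable_weight_past (s := s) hb k l).pow_const 4)
    (φ := fun x => x l ^ 4) ((measurable_pi_apply l).pow_const 4)
  have := ind.integrable_mul ((memLp_four_iff_integrable_pow hw).1 (h.memLp_weight s b k l))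
    ((memLp_four_iff_integrable_pow hv).1 (h.memLp_four k l))
  convert! this using 2 with ω
  simp [mul_pow]

lemma memLp_four_weightedDiff (h : IsCenteredIndep μ v κ) (hb : ∀ p k j, k ≤ j → b p k j = 0)
    (k : Fin n) : MemLp (weightedDiff s b v k) 4 μ :=
  memLp_finsetSum _ fun l _ => h.memLp_four_weight_mul hb k l

/-- Y times the weight is independent of the centered `v k`. Complex Y serve as test functions for
characteristic functions; real square-integrable Y cover the partial sums, which are unbounded. -/
lemma integral_mul_weightedDiff (h : IsCenteredIndep μ v κ) (hb : ∀ p k j, k ≤ j → b p k j = 0)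
    (k : Fin n) {𝕜 : Type*} [RCLike 𝕜] {Y : Ω → 𝕜} (hYm : Measurable[pastSigma v k] Y)
    (hY : MemLp Y 2 μ) : ∫ ω, Y ω * (weightedDiff s b v k ω : 𝕜) ∂μ = 0 := by
  have e : ∀ ω, Y ω * (weightedDiff s b v k ω : 𝕜) =
      ∑ l, (Y ω * (weight s b v k ω l : 𝕜)) * (v k ω l : 𝕜) := fun ω => by
    simp only [weightedDiff]
    push_cast
    rw [Finset.mul_sum]
    exact Finset.sum_congr rfl fun l _ => by ring
  have hi : ∀ l, Integrable (fun ω => (Y ω * (weight s b v k ω l : 𝕜)) * (v k ω l : 𝕜)) μ :=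
    fun l => by
      have h2 : MemLp (fun ω => ((weight s b v k ω l * v k ω l : ℝ) : 𝕜)) 2 μ :=
        ((h.memLp_four_weight_mul hb k l).mono_exponent (by norm_num)).ofReal
      convert! hY.integrable_mul h2 using 2 with ω
      simp only [Pi.mul_apply]
      push_cast
      ring
  simp_rw [e]
  rw [integral_finsetSum _ fun l _ => hi l]
  refine Finset.sum_eq_zero fun l _ => ?_
  have mw : Measurable[pastSigma v k] (fun ω => Y ω * (weight s b v k ω l : 𝕜)) :=
    hYm.mul (RCLike.measurable_ofReal.comp (measurable_weight_past hb k l))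
  have ind := h.indepFun_past k mw (φ := fun x => (x l : 𝕜))
    (RCLike.measurable_ofReal.comp (measurable_pi_apply l))
  rw [ind.integral_fun_mul_eq_mul_integral (mw.mono (h.past_le _) le_rfl).aestronglyMeasurable
    (RCLike.measurable_ofReal.comp (h.measurable_coord k l)).aestronglyMeasurable,
    integral_ofReal, h.integral_eq_zero]
  simp

lemma integral_mul_weightedDiff_sq (h : IsCenteredIndep μ v κ)
    (hb : ∀ p k j, k ≤ j → b p k j = 0) (k : Fin n) {Y : Ω → ℂ}
    (hYm : Measurable[pastSigma v k] Y) {C : ℝ} (hC : ∀ ω, ‖Y ω‖ ≤ C) :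
    ∫ ω, Y ω * ((weightedDiff s b v k ω ^ 2 : ℝ) : ℂ) ∂μ =
      ∫ ω, Y ω * (covForm μ v k (weight s b v k ω) : ℂ) ∂μ := by
  set w : Fin d → Ω → ℝ := fun l ω => weight s b v k ω l with hw
  have mw : ∀ l, Measurable[pastSigma v k] (w l) := fun l => measurable_weight_past hb k l
  have ww : ∀ l l', MemLp (fun ω => w l ω * w l' ω) 2 μ := fun l l' =>
    memLp_two_mul_of_memLp_four (h.memLp_weight s b k l) (h.memLp_weight s b k l')
  have vv : ∀ l l', MemLp (fun ω => v k ω l * v k ω l') 2 μ := fun l l' =>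
    memLp_two_mul_of_memLp_four (h.memLp_four k l) (h.memLp_four k l')
  have aY : AEStronglyMeasurable Y μ := (hYm.mono (h.past_le _) le_rfl).aestronglyMeasurable
  have e1 : ∀ ω, Y ω * ((weightedDiff s b v k ω ^ 2 : ℝ) : ℂ) =
      ∑ l, ∑ l', (Y ω * ((w l ω * w l' ω : ℝ) : ℂ)) * ((v k ω l * v k ω l' : ℝ) : ℂ) := fun ω => by
    rw [weightedDiff, sq, Finset.sum_mul_sum]
    push_cast
    simp_rw [Finset.mul_sum]
    exact Finset.sum_congr rfl fun l _ => Finset.sum_congr rfl fun l' _ => by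
      simp only [hw]; ring
  have e2 : ∀ ω, Y ω * (covForm μ v k (weight s b v k ω) : ℂ) =
      ∑ l, ∑ l', (Y ω * ((w l ω * w l' ω : ℝ) : ℂ)) * (coordCov μ v k l l' : ℂ) := fun ω => by
    rw [covForm]
    push_cast
    simp_rw [Finset.mul_sum]
    exact Finset.sum_congr rfl fun l _ => Finset.sum_congr rfl fun l' _ => by
      simp only [hw]; ring
  have i1 : ∀ l l', Integrable (fun ω => (Y ω * ((w l ω * w l' ω : ℝ) : ℂ)) *
      ((v k ω l * v k ω l' : ℝ) : ℂ)) μ := fun l l' => by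
    have : Integrable (fun ω => (w l ω * w l' ω) * (v k ω l * v k ω l')) μ :=
      (ww l l').integrable_mul (vv l l')
    refine (this.ofReal.bdd_mul aY (c := C) (ae_of_all _ hC)).congr (ae_of_all _ fun ω => ?_)
    simp only [Complex.coe_algebraMap, RCLike.ofReal_mul]
    push_cast
    ring
  have i2 : ∀ l l', Integrable (fun ω => (Y ω * ((w l ω * w l' ω : ℝ) : ℂ)) *
      (coordCov μ v k l l' : ℂ)) μ := fun l l' =>
    ((((ww l l').integrable (by norm_num)).ofReal).bdd_mul aY (c := C) (ae_of_all _ hC)).mul_const _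
  simp_rw [e1, e2]
  rw [integral_finsetSum _ fun l _ => integrable_finsetSum _ fun l' _ => i1 l l',
    integral_finsetSum _ fun l _ => integrable_finsetSum _ fun l' _ => i2 l l']
  refine Finset.sum_congr rfl fun l _ => ?_
  rw [integral_finsetSum _ fun l' _ => i1 l l', integral_finsetSum _ fun l' _ => i2 l l']
  refine Finset.sum_congr rfl fun l' _ => ?_
  have mY : Measurable[pastSigma v k] (fun ω => Y ω * ((w l ω * w l' ω : ℝ) : ℂ)) :=
    hYm.mul (Complex.measurable_ofReal.comp ((mw l).mul (mw l')))
  have mφ : Measurable (fun x : Fin d → ℝ => ((x l * x l' : ℝ) : ℂ)) :=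
    Complex.measurable_ofReal.comp ((measurable_pi_apply l).mul (measurable_pi_apply l'))
  have ind := h.indepFun_past k mY mφ
  rw [ind.integral_fun_mul_eq_mul_integral (mY.mono (h.past_le _) le_rfl).aestronglyMeasurable
    (mφ.comp (h.measurable k)).aestronglyMeasurable, integral_mul_const, integral_complex_ofReal,
    coordCov]

lemma integral_weightedDiff_pow_four_le (h : IsCenteredIndep μ v κ)
    (hb : ∀ p k j, k ≤ j → b p k j = 0) (k : Fin n) :
    ∫ ω, weightedDiff s b v k ω ^ 4 ∂μ ≤ d ^ 3 * ∑ l, κ ^ 2 *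
      (8 * (s k l ^ 4 + d ^ 3 * ∑ l', 3 * κ ^ 2 * (∑ j, b (l, l') k j ^ 2) ^ 2)) := by
  have hw := fun l => h.measurable_weight (s := s) hb k l
  have hv := fun l => h.measurable_coord k l
  have hi : ∀ l, Integrable (fun ω => (weight s b v k ω l * v k ω l) ^ 4) μ := fun l =>
    (memLp_four_iff_integrable_pow ((hw l).mul (hv l))).1 (h.memLp_four_weight_mul hb k l)
  have hX : Measurable (weightedDiff s b v k) :=
    (measurable_weightedDiff_past hb k).mono (h.past_le _) le_rfl
  calc ∫ ω, weightedDiff s b v k ω ^ 4 ∂μ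
      ≤ ∫ ω, (d : ℝ) ^ 3 * ∑ l, (weight s b v k ω l * v k ω l) ^ 4 ∂μ := by
        refine integral_mono ((memLp_four_iff_integrable_pow hX).1 (h.memLp_four_weightedDiff hb k))
          ((integrable_finsetSum _ fun l _ => hi l).const_mul _) fun ω => ?_
        simpa [weightedDiff] using! pow_four_sum_le Finset.univ (fun l => weight s b v k ω l * v k ω l)
    _ = d ^ 3 * ∑ l, ∫ ω, (weight s b v k ω l * v k ω l) ^ 4 ∂μ := by
        rw [integral_const_mul, integral_finsetSum _ fun l _ => hi l]
    _ ≤ _ := by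
        gcongr with l _
        have ind := h.indepFun_past k (measurable_weight_past (s := s) hb k l)
          (φ := fun x => x l) (measurable_pi_apply l)
        rw [ind.integral_mul_pow (hw l) (hv l), mul_comm]
        have hκ := h.nonneg
        have h4 : 0 ≤ ∫ ω, weight s b v k ω l ^ 4 ∂μ := by positivity
        exact mul_le_mul (h.integral_pow_four_le k l) (h.integral_pow_four_weight_le s b k l)
          h4 (by positivity)

/-- The squared row norms of b p are the diagonal of its Gram matrix, so summing their squares over
k costs at most γ for each of the d² pairs. -/
lemma sum_integral_weightedDiff_pow_four_le (h : IsCenteredIndep μ v κ)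
    (hb : ∀ p k j, k ≤ j → b p k j = 0) {γ : ℝ} (hγ : ∀ p, gramNormSq (b p) ≤ γ) :
    ∑ k, ∫ ω, weightedDiff s b v k ω ^ 4 ∂μ ≤
      8 * d ^ 3 * κ ^ 2 * (∑ l, ∑ k, s k l ^ 4 + 3 * d ^ 5 * κ ^ 2 * γ) := by
  have hs : ∀ l l', ∑ k, (∑ j, b (l, l') k j ^ 2) ^ 2 ≤ γ := fun l l' =>
    (sum_sq_sum_sq_le _).trans (hγ (l, l'))
  calc ∑ k, ∫ ω, weightedDiff s b v k ω ^ 4 ∂μ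
      ≤ ∑ k, (d : ℝ) ^ 3 * ∑ l, κ ^ 2 *
      (8 * (s k l ^ 4 + d ^ 3 * ∑ l', 3 * κ ^ 2 * (∑ j, b (l, l') k j ^ 2) ^ 2)) :=
        Finset.sum_le_sum fun k _ => h.integral_weightedDiff_pow_four_le hb k
    _ = 8 * d ^ 3 * κ ^ 2 * (∑ l, ∑ k, s k l ^ 4 + d ^ 3 * (3 * κ ^ 2 *
          ∑ l, ∑ l', ∑ k, (∑ j, b (l, l') k j ^ 2) ^ 2)) := by
        have e : ∑ l, ∑ l', ∑ k, (∑ j, b (l, l') k j ^ 2) ^ 2 =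
            ∑ k, ∑ l, ∑ l', (∑ j, b (l, l') k j ^ 2) ^ 2 := by
          exact (Finset.sum_congr rfl fun l _ => Finset.sum_comm).trans Finset.sum_comm
        rw [e, Finset.sum_comm (f := fun l k => s k l ^ 4)]
        simp_rw [← Finset.mul_sum, Finset.sum_add_distrib, ← Finset.mul_sum]
        ring
    _ ≤ 8 * d ^ 3 * κ ^ 2 * (∑ l, ∑ k, s k l ^ 4 + d ^ 3 * (3 * κ ^ 2 *
          ∑ l : Fin d, ∑ l' : Fin d, γ)) := by
        gcongr with l _ l' _
        exact hs l l'
    _ = _ := by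
        simp only [Finset.sum_const, Finset.card_univ, Fintype.card_fin, nsmul_eq_mul]
        ring

lemma isMartingaleDifference (h : IsCenteredIndep μ v κ) (hb : ∀ p k j, k ≤ j → b p k j = 0) :
    IsMartingaleDifference μ (pastSigma v) (extendZero (weightedDiff s b v))
      (extendZero fun k ω => covForm μ v k (weight s b v k ω)) := by
  refine ⟨h.past_le, fun N N' hN => generatedBy_mono v fun j hj => lt_of_lt_of_le hj hN,
    fun N => ?_, fun N => ?_, fun N ω => ?_, fun N => ?_, fun N => ?_, fun N Y hYm hYb => ?_,
    fun N Y hYm hYb => ?_⟩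
  all_goals by_cases hN : N < n
  all_goals simp only [extendZero_of_lt, extendZero_of_not_lt, hN, not_false_eq_true]
  · exact measurable_weightedDiff_past hb ⟨N, hN⟩
  · exact measurable_const
  · exact measurable_covForm_past hb ⟨N, hN⟩
  · exact measurable_const
  · exact h.covForm_nonneg _ _
  · exact le_rfl
  · exact integrable_finsetSum _ fun l _ => integrable_finsetSum _ fun l' _ =>
      ((memLp_two_mul_of_memLp_four (h.memLp_weight s b _ l)
        (h.memLp_weight s b _ l')).integrable (by norm_num)).const_mul _
  · exact integrable_const _
  · exact (memLp_four_iff_integrable_pow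
      ((measurable_weightedDiff_past hb ⟨N, hN⟩).mono (h.past_le _) le_rfl)).1
      (h.memLp_four_weightedDiff hb ⟨N, hN⟩)
  · exact integrable_const _
  · obtain ⟨C, hC⟩ := hYb
    exact h.integral_mul_weightedDiff hb ⟨N, hN⟩ hYm
      (MemLp.of_bound (hYm.mono (h.past_le _) le_rfl).aestronglyMeasurable C (ae_of_all _ hC))
  · simp
  · obtain ⟨C, hC⟩ := hYb
    exact h.integral_mul_weightedDiff_sq hb ⟨N, hN⟩ hYm hC
  · simp

/-- Martingale differences are orthogonal. This identifies the mean of V with the second moment of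
the sum, so normalizing the latter to 1 centers V at 1. -/
lemma integral_sq_sum_weightedDiff (h : IsCenteredIndep μ v κ)
    (hb : ∀ p k j, k ≤ j → b p k j = 0) :
    ∫ ω, (∑ k, weightedDiff s b v k ω) ^ 2 ∂μ = ∫ ω, ∑ k, covForm μ v k (weight s b v k ω) ∂μ := by
  have hM := h.isMartingaleDifference (s := s) hb
  set X := extendZero (weightedDiff s b v)
  set q := extendZero fun k ω => covForm μ v k (weight s b v k ω)
  have hX2 : ∀ k, MemLp (X k) 2 μ := fun k => (hM.memLp_four k).mono_exponent (by norm_num)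
  have key : ∀ N, ∫ ω, (∑ k ∈ Finset.range N, X k ω) ^ 2 ∂μ =
      ∑ k ∈ Finset.range N, ∫ ω, q k ω ∂μ := by
    intro N
    induction N with
    | zero => simp
    | succ N ih =>
      set S : Ω → ℝ := fun ω => ∑ k ∈ Finset.range N, X k ω with hS
      have S2 : MemLp S 2 μ := memLp_finsetSum _ fun k _ => hX2 k
      have mS : Measurable[pastSigma v N] S := Finset.measurable_fun_sum _ fun k hk =>
        (hM.measurable_diff k).mono (hM.mono (Finset.mem_range.1 hk)) le_rfl
      have cross : ∫ ω, S ω * X N ω ∂μ = 0 := by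
        by_cases hN : N < n
        · have := h.integral_mul_weightedDiff (s := s) hb ⟨N, hN⟩ mS S2
          simpa [X, extendZero_of_lt _ hN] using! this
        · simp [X, extendZero_of_not_lt _ hN]
      have e : ∀ ω, (∑ k ∈ Finset.range (N + 1), X k ω) ^ 2 =
          S ω ^ 2 + X N ω ^ 2 + 2 * (S ω * X N ω) := fun ω => by
        rw [Finset.sum_range_succ]; ring
      have i1 : Integrable (fun ω => S ω ^ 2 + X N ω ^ 2) μ :=
        S2.integrable_sq.add (hX2 N).integrable_sq
      have i2 : Integrable (fun ω => 2 * (S ω * X N ω)) μ := (S2.integrable_mul (hX2 N)).const_mul 2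
      simp_rw [e]
      rw [integral_add i1 i2, integral_add S2.integrable_sq (hX2 N).integrable_sq,
        integral_const_mul, cross, ih, hM.integral_sq, Finset.sum_range_succ]
      simp
  have k1 := key n
  rw [← integral_finsetSum _ fun k _ => hM.integrable_condVar k] at k1
  simpa only [X, q, sum_range_extendZero] using k1

end IsCenteredIndep

end WeightedDifferences

/-! ### The statistic as a martingale. -/

section QuadraticStatistic

variable {Ω : Type*} {m : MeasurableSpace Ω} {d n : ℕ}

lemma integral_abs_le_sqrt {μ : Measure Ω} [IsProbabilityMeasure μ] {f : Ω → ℝ}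
    (hf : MemLp f 2 μ) : ∫ ω, |f ω| ∂μ ≤ √(∫ ω, f ω ^ 2 ∂μ) := by
  apply Real.le_sqrt_of_sq_le
  have h1 := variance_nonneg (fun ω => |f ω|) μ
  rw [variance_eq_sub (show MemLp (fun ω => |f ω|) 2 μ from hf.abs)] at h1
  simp only [Pi.pow_apply, sq_abs] at h1
  linarith

/-- Since V has mean 1, E|V - 1| is at most the standard deviation of V; with the fourth moment
bound this supplies both inputs of the martingale estimate. -/
lemma IsCenteredIndep.norm_integral_exp_sub_le {μ : Measure Ω} [IsProbabilityMeasure μ]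
    {v : Fin n → Ω → Fin d → ℝ} {κ : ℝ} (h : IsCenteredIndep μ v κ) {s : Fin n → Fin d → ℝ}
    {b : Fin d × Fin d → Matrix (Fin n) (Fin n) ℝ} (hb : ∀ p k j, k ≤ j → b p k j = 0) {γ : ℝ}
    (hγ : ∀ p, gramNormSq (b p) ≤ γ)
    (h1 : ∫ ω, (∑ k, weightedDiff s b v k ω) ^ 2 ∂μ = 1) (t : ℝ) {δ : ℝ} (hδ : 0 < δ) {L : ℝ}
    (hL : 8 * d ^ 3 * κ ^ 2 * (∑ l, ∑ k, s k l ^ 4 + 3 * d ^ 5 * κ ^ 2 * γ) ≤ L) :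
    ‖∫ ω, Complex.exp ((t * ∑ k, weightedDiff s b v k ω : ℝ) * Complex.I) ∂μ -
        Complex.exp (-t ^ 2 / 2)‖ ≤
      (1 + (1 + t ^ 2) * Real.exp (t ^ 2)) *
        √(8 * d ^ 4 * κ ^ 2 * √γ + 6 * d ^ 8 * κ ^ 4 * γ) +
      (Real.exp (t ^ 2) * (t ^ 4 * L) +
        4 * Real.exp (t ^ 2) * (δ * t ^ 2 * 2 + t ^ 4 / δ * L)) := by
  have hM := (h.isMartingaleDifference (s := s) hb).norm_integral_exp_sub_le t hδ n
  simp only [Finset.sum_range, extendZero_coe] at hM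
  obtain ⟨V2, hV⟩ := h.integral_sum_covForm_weight s b hγ
  rw [h.integral_sq_sum_weightedDiff hb] at h1
  rw [h1, mul_one] at hV
  have hL' := (h.sum_integral_weightedDiff_pow_four_le (s := s) hb hγ).trans hL
  refine hM.trans ?_
  gcongr
  exact (integral_abs_le_sqrt (V2.sub (memLp_const 1))).trans (Real.sqrt_le_sqrt hV)

/-- The coefficient matrices of `quadraticStat` when the larger index of each pair is put first. -/
def lowerCoeff (G : Matrix (Fin n) (Fin n) ℝ) (A : Matrix (Fin d) (Fin d) ℝ) (p : Fin d × Fin d) :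
    Matrix (Fin n) (Fin n) ℝ :=
  fun k j => A p.1 p.2 * strictLower G k j + A p.2 p.1 * (strictUpper G)ᵀ k j

lemma lowerCoeff_eq_zero (G : Matrix (Fin n) (Fin n) ℝ) (A : Matrix (Fin d) (Fin d) ℝ)
    (p : Fin d × Fin d) (k j : Fin n) (h : k ≤ j) : lowerCoeff G A p k j = 0 := by
  simp [lowerCoeff, strictLower, strictUpper, not_lt.2 h]

lemma gramNormSq_lowerCoeff_le (G : Matrix (Fin n) (Fin n) ℝ) {A : Matrix (Fin d) (Fin d) ℝ}
    {a : ℝ} (hA : ∀ k l, |A k l| ≤ a) (p : Fin d × Fin d) :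
    gramNormSq (lowerCoeff G A p) ≤ 8 * a ^ 4 *
      (‖strictLower G * (strictLower G)ᵀ‖ + ‖strictUpper G * (strictUpper G)ᵀ‖) ^ 2 := by
  refine (gramNormSq_linear_comb_le _ _ (hA _ _) (hA _ _)).trans ?_
  rw [gramNormSq_transpose, gramNormSq_eq_norm_sq, gramNormSq_eq_norm_sq]
  gcongr
  have := norm_nonneg (strictLower G * (strictLower G)ᵀ)
  have := norm_nonneg (strictUpper G * (strictUpper G)ᵀ)
  nlinarith

/-- For j < k the pair contributes G_kj v_k'Av_j and G_jk v_j'Av_k. The second is rewritten with A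
transposed so that `v k` stands first, which is why `lowerCoeff` pairs A p.2 p.1 with the transpose
of G_U. -/
lemma quadraticStat_eq_sum_weightedDiff (s : Fin n → Fin d → ℝ) (G : Matrix (Fin n) (Fin n) ℝ)
    (A : Matrix (Fin d) (Fin d) ℝ) (v : Fin n → Ω → Fin d → ℝ) (ω : Ω) :
    quadraticStat s G A v ω = ∑ k, weightedDiff s (lowerCoeff G A) v k ω := by
  set B : Fin n → Fin n → ℝ := fun i j => v i ω ⬝ᵥ (A *ᵥ v j ω) with hB
  have hBe : ∀ i j, B i j = ∑ l, ∑ l', A l l' * v i ω l * v j ω l' := fun i j => by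
    simp only [hB, dotProduct, Matrix.mulVec, Finset.mul_sum]
    exact Finset.sum_congr rfl fun l _ => Finset.sum_congr rfl fun l' _ => by ring
  have hBe' : ∀ i j, B j i = ∑ l, ∑ l', A l' l * v i ω l * v j ω l' := fun i j => by
    rw [hBe, Finset.sum_comm]
    exact Finset.sum_congr rfl fun l _ => Finset.sum_congr rfl fun l' _ => by ring
  have e1 : ∀ k, weightedDiff s (lowerCoeff G A) v k ω = s k ⬝ᵥ v k ω +
      ∑ j, (strictLower G k j * B k j + strictUpper G j k * B j k) := by
    intro k
    have : ∀ j, strictLower G k j * B k j + strictUpper G j k * B j k =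
        ∑ l, ∑ l', lowerCoeff G A (l, l') k j * v k ω l * v j ω l' := fun j => by
      rw [hBe, hBe', Finset.mul_sum, Finset.mul_sum, ← Finset.sum_add_distrib]
      refine Finset.sum_congr rfl fun l _ => ?_
      rw [Finset.mul_sum, Finset.mul_sum, ← Finset.sum_add_distrib]
      refine Finset.sum_congr rfl fun l' _ => ?_
      simp only [lowerCoeff, Matrix.transpose_apply]
      ring
    simp_rw [this]
    rw [Finset.sum_comm, dotProduct, weightedDiff, ← Finset.sum_add_distrib]
    refine Finset.sum_congr rfl fun l _ => ?_
    rw [Finset.sum_comm]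
    simp only [weight, rowSum, add_mul, Finset.sum_mul]
    congr 1
    exact Finset.sum_congr rfl fun l' _ => Finset.sum_congr rfl fun j _ => by ring
  have e2 : ∀ i, ∑ j ∈ Finset.univ.filter (fun j => j ≠ i), G i j * B i j =
      ∑ j, (strictLower G i j * B i j + strictUpper G i j * B i j) := fun i => by
    rw [Finset.sum_filter]
    refine Finset.sum_congr rfl fun j _ => ?_
    rcases lt_trichotomy i j with hij | hij | hij
    · simp [strictLower, strictUpper, hij, hij.ne', not_lt.2 hij.le]
    · simp [strictLower, strictUpper, hij]
    · simp [strictLower, strictUpper, hij, hij.ne, not_lt.2 hij.le]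
  rw [quadraticStat]
  simp_rw [e1]
  rw [Finset.sum_add_distrib]
  congr 1
  rw [Finset.sum_congr rfl fun i _ => e2 i]
  simp_rw [Finset.sum_add_distrib]
  congr 1
  exact Finset.sum_comm

/-- The normalization is absorbed into s and A, leaving G, and hence the Gram matrix hypothesis,
untouched. -/
lemma quadraticStat_const_mul (c : ℝ) (s : Fin n → Fin d → ℝ) (G : Matrix (Fin n) (Fin n) ℝ)
    (A : Matrix (Fin d) (Fin d) ℝ) (v : Fin n → Ω → Fin d → ℝ) (ω : Ω) :
    quadraticStat (fun i => c • s i) G (c • A) v ω = c * quadraticStat s G A v ω := by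
  simp only [quadraticStat, smul_dotProduct, Matrix.smul_mulVec, dotProduct_smul, smul_eq_mul,
    mul_add, Finset.mul_sum]
  congr 1
  exact Finset.sum_congr rfl fun i _ => Finset.sum_congr rfl fun j _ => by ring

lemma measurable_quadraticStat (s : Fin n → Fin d → ℝ) (G : Matrix (Fin n) (Fin n) ℝ)
    (A : Matrix (Fin d) (Fin d) ℝ) {v : Fin n → Ω → Fin d → ℝ} (hv : ∀ i, Measurable (v i)) :
    Measurable (quadraticStat s G A v) := by
  have hv' : ∀ i l, Measurable fun ω => v i ω l := fun i l =>
    (measurable_pi_apply l).comp (hv i)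
  unfold quadraticStat
  simp only [dotProduct, Matrix.mulVec]
  fun_prop

lemma IsCenteredIndep.integral_quadraticStat {μ : Measure Ω} [IsProbabilityMeasure μ]
    {v : Fin n → Ω → Fin d → ℝ} {κ : ℝ} (h : IsCenteredIndep μ v κ) (s : Fin n → Fin d → ℝ)
    (G : Matrix (Fin n) (Fin n) ℝ) (A : Matrix (Fin d) (Fin d) ℝ) :
    ∫ ω, quadraticStat s G A v ω ∂μ = 0 := by
  have hb := lowerCoeff_eq_zero G A
  simp_rw [quadraticStat_eq_sum_weightedDiff]
  rw [integral_finsetSum _ fun k _ => (h.memLp_four_weightedDiff hb k).integrable (by norm_num)]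
  refine Finset.sum_eq_zero fun k _ => ?_
  simpa using! h.integral_mul_weightedDiff (s := s) hb k (𝕜 := ℝ) (Y := fun _ => 1)
    measurable_const (memLp_const 1)

end QuadraticStatistic

/-! ### The central limit theorem. -/

theorem lemma2
    {d : ℕ} {Ω : ℕ → Type*} [∀ n, MeasurableSpace (Ω n)]
    (μ : ∀ n, Measure (Ω n)) [∀ n, IsProbabilityMeasure (μ n)]
    (v : ∀ n, Fin n → Ω n → Fin d → ℝ)
    (s : ∀ n, Fin n → Fin d → ℝ)
    (G : ∀ n, Matrix (Fin n) (Fin n) ℝ)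
    (A : ℕ → Matrix (Fin d) (Fin d) ℝ)
    (hA : ∃ C : ℝ, ∀ n, ∀ k l, |A n k l| ≤ C)
    (hmeas : ∀ n i, Measurable (v n i))
    (hindep : ∀ n, iIndepFun (v n) (μ n))
    (hmean : ∀ n i l, ∫ ω, v n i ω l ∂(μ n) = 0)
    (hmoment : ∃ C : ℝ, ∀ n i l,
      Integrable (fun ω => v n i ω l ^ 4) (μ n) ∧ ∫ ω, v n i ω l ^ 4 ∂(μ n) ≤ C)
    (hvar : ∃ C : ℝ, ∀ᶠ n in atTop,
      0 < Var[quadraticStat (s n) (G n) (A n) (v n); μ n] ∧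
        Var[quadraticStat (s n) (G n) (A n) (v n); μ n] ^ (-(1 / 2) : ℝ) ≤ C)
    (hs : ∀ l, Tendsto (fun n => ∑ i, s n i l ^ 4) atTop (𝓝 0))
    (hG : Tendsto (fun n =>
      ‖strictLower (G n) * (strictLower (G n))ᵀ‖ + ‖strictUpper (G n) * (strictUpper (G n))ᵀ‖)
      atTop (𝓝 0)) :
    TendstoInDistribution
      (fun n ω => Var[quadraticStat (s n) (G n) (A n) (v n); μ n] ^ (-(1 / 2) : ℝ) *
        quadraticStat (s n) (G n) (A n) (v n) ω)
      atTop (id : ℝ → ℝ) μ (gaussianReal 0 1) := by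
  obtain ⟨CA, hA⟩ := hA
  obtain ⟨Cm, hmoment⟩ := hmoment
  obtain ⟨Cv, hvar⟩ := hvar
  -- Taking κ ≥ 1 gives Cm ≤ κ ≤ κ², the form in which fourth moments are bounded.
  set κ := max Cm 1 with hκ
  have hκ1 : 1 ≤ κ := le_max_right _ _
  have hI : ∀ n, IsCenteredIndep (μ n) (v n) κ := fun n => by
    refine ⟨hmeas n, hindep n, by linarith, fun k l => ?_, hmean n, fun k l => ?_⟩
    · exact (memLp_four_iff_integrable_pow ((measurable_pi_apply l).comp (hmeas n k))).2
        (hmoment n k l).1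
    · have := (hmoment n k l).2
      have : Cm ≤ κ := le_max_left _ _
      nlinarith
  have hT : ∀ n, Measurable (quadraticStat (s n) (G n) (A n) (v n)) := fun n =>
    measurable_quadraticStat _ _ _ (hmeas n)
  refine ⟨fun n => ((hT n).const_mul _).aemeasurable, aemeasurable_id, ?_⟩
  refine ProbabilityMeasure.tendsto_iff_tendsto_charFun.2 fun t => ?_
  simp only [ProbabilityMeasure.coe_mk, Measure.map_id, charFun_gaussianReal]
  set g : ℕ → ℝ := fun n =>
    ‖strictLower (G n) * (strictLower (G n))ᵀ‖ + ‖strictUpper (G n) * (strictUpper (G n))ᵀ‖ with hg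
  set γ : ℕ → ℝ := fun n => 8 * (Cv * CA) ^ 4 * g n ^ 2 with hγ
  set L : ℕ → ℝ := fun n => 8 * d ^ 3 * κ ^ 2 *
    (Cv ^ 4 * ∑ l, ∑ k, s n k l ^ 4 + 3 * d ^ 5 * κ ^ 2 * γ n) with hLdef
  -- √L balances δ against L/δ; the added 1/(n + 1) keeps δ positive when L vanishes.
  set δ : ℕ → ℝ := fun n => √(L n) + 1 / ((n : ℝ) + 1) with hδdef
  set R : ℕ → ℝ := fun n => (1 + (1 + t ^ 2) * Real.exp (t ^ 2)) *
        √(8 * d ^ 4 * κ ^ 2 * √(γ n) + 6 * d ^ 8 * κ ^ 4 * γ n) +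
      (Real.exp (t ^ 2) * (t ^ 4 * L n) +
        4 * Real.exp (t ^ 2) * (δ n * t ^ 2 * 2 + t ^ 4 * √(L n))) with hR
  have γ0 : ∀ n, 0 ≤ γ n := fun n => by positivity
  have L0 : ∀ n, 0 ≤ L n := fun n => by have := γ0 n; positivity
  have δ0 : ∀ n, 0 < δ n := fun n => by positivity
  have tγ : Tendsto γ atTop (𝓝 0) := by
    simpa using (hG.pow 2).const_mul (8 * (Cv * CA) ^ 4)
  have tS : Tendsto (fun n => ∑ l, ∑ k, s n k l ^ 4) atTop (𝓝 0) := by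
    simpa using tendsto_finsetSum (Finset.univ : Finset (Fin d)) fun l _ => hs l
  have tL : Tendsto L atTop (𝓝 0) := by
    simpa using ((tS.const_mul (Cv ^ 4)).add (tγ.const_mul (3 * d ^ 5 * κ ^ 2))).const_mul
      (8 * d ^ 3 * κ ^ 2)
  have tsL : Tendsto (fun n => √(L n)) atTop (𝓝 0) := by simpa using tL.sqrt
  have tδ : Tendsto δ atTop (𝓝 0) := by
    simpa [hδdef] using tsL.add tendsto_one_div_add_atTop_nhds_zero_nat
  have tR : Tendsto R atTop (𝓝 0) := by
    have t1 := ((tγ.sqrt.const_mul (8 * d ^ 4 * κ ^ 2)).add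
      (tγ.const_mul (6 * d ^ 8 * κ ^ 4))).sqrt.const_mul (1 + (1 + t ^ 2) * Real.exp (t ^ 2))
    have t2 := (tL.const_mul (t ^ 4)).const_mul (Real.exp (t ^ 2))
    have t3 := (((tδ.mul_const (t ^ 2)).mul_const 2).add (tsL.const_mul (t ^ 4))).const_mul
      (4 * Real.exp (t ^ 2))
    simpa using t1.add (t2.add t3)
  rw [tendsto_iff_norm_sub_tendsto_zero]
  refine squeeze_zero' (Eventually.of_forall fun n => norm_nonneg _) ?_ tR
  filter_upwards [hvar] with n hn
  obtain ⟨hpos, hle⟩ := hn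
  set σ := Var[quadraticStat (s n) (G n) (A n) (v n); μ n] with hσ
  set c : ℝ := σ ^ (-(1 / 2) : ℝ) with hc
  have hc0 : 0 ≤ c := by positivity
  have hc2 : c ^ 2 * σ = 1 := by
    rw [hc, ← Real.rpow_natCast, ← Real.rpow_mul hpos.le, ← Real.rpow_add_one hpos.ne']
    norm_num
  have hTe : ∀ ω, c * quadraticStat (s n) (G n) (A n) (v n) ω =
      ∑ k, weightedDiff (fun i => c • s n i) (lowerCoeff (G n) (c • A n)) (v n) k ω := fun ω => by
    rw [← quadraticStat_const_mul, quadraticStat_eq_sum_weightedDiff]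
  have hone : ∫ ω, (∑ k, weightedDiff (fun i => c • s n i) (lowerCoeff (G n) (c • A n)) (v n) k ω)
      ^ 2 ∂(μ n) = 1 := by
    simp_rw [← hTe, mul_pow]
    rw [integral_const_mul, ← hc2, hσ, variance_of_integral_eq_zero (hT n).aemeasurable
      ((hI n).integral_quadraticStat _ _ _)]
  -- Boundedness of Var(T)^(-1/2) enters here and in `hLn`: the rescaled A and s obey bounds of the
  -- same type as the original ones.
  have hAc : ∀ k l, |(c • A n) k l| ≤ Cv * CA := fun k l => by
    rw [Matrix.smul_apply, smul_eq_mul, abs_mul, abs_of_nonneg hc0]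
    exact mul_le_mul hle (hA n k l) (abs_nonneg _) (hc0.trans hle)
  have hLn : 8 * d ^ 3 * κ ^ 2 * (∑ l, ∑ k, (c • s n k) l ^ 4 + 3 * d ^ 5 * κ ^ 2 * γ n) ≤ L n := by
    simp only [Pi.smul_apply, smul_eq_mul, mul_pow, ← Finset.mul_sum, hLdef]
    gcongr
  have main := (hI n).norm_integral_exp_sub_le (lowerCoeff_eq_zero (G n) (c • A n))
    (gramNormSq_lowerCoeff_le (G n) hAc) hone t (δ0 n) hLn
  have hLδ : t ^ 4 / δ n * L n ≤ t ^ 4 * √(L n) := by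
    have h1 : L n / δ n ≤ √(L n) := by
      rw [div_le_iff₀ (δ0 n)]
      calc L n = √(L n) * √(L n) := (Real.mul_self_sqrt (L0 n)).symm
        _ ≤ √(L n) * δ n := by
          gcongr
          simp only [hδdef]
          have : (0 : ℝ) ≤ 1 / ((n : ℝ) + 1) := by positivity
          linarith
    calc t ^ 4 / δ n * L n = t ^ 4 * (L n / δ n) := by ring
      _ ≤ _ := by gcongr
  have hchar : charFun ((μ n).map (fun ω => c * quadraticStat (s n) (G n) (A n) (v n) ω)) t =
      ∫ ω, Complex.exp ((t * ∑ k, weightedDiff (fun i => c • s n i)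
        (lowerCoeff (G n) (c • A n)) (v n) k ω : ℝ) * Complex.I) ∂(μ n) := by
    rw [charFun_apply_real, integral_map ((hT n).const_mul _).aemeasurable (by fun_prop)]
    simp_rw [← hTe]
    push_cast
    rfl
  have hgauss : Complex.exp ((t : ℂ) * ((0 : ℝ) : ℂ) * Complex.I - ((1 : NNReal) : ℂ) * t ^ 2 / 2) =
      Complex.exp (-t ^ 2 / 2) := by
    congr 1
    push_cast
    ring
  rw [hchar, hgauss]
  refine main.trans ?_
  simp only [hR]
  gcongr
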